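/- **Model.** In the congested clique there are $n$ nodes $1,\dots,n$ and computation proceeds in synchronous rounds; in each round every node sends to each node a message of $\lceil\log_2 n\rceil$ bits (messages to different nodes may differ). Local computation is unrestricted, and each node has private randomness, namely a seed drawn uniformly from a finite set, the seeds of different nodes being independent. The input is a simple graph $G$ on the vertex set $\{1,\dots,n\}$, and initially node $\ell$ knows only its own name, its neighbours in $G$ and its seed. A graph problem has randomized round complexity $O(g(n))$ if for every $c\in\mathbb N$ there are a constant $C$ and, for each $n\ge 2$, a protocol that stops after at most $C\,g(n)$ rounds and such that, for every input graph $G$ on $\{1,\dots,n\}$, with probability at least $1-n^{-c}$ all nodes output the correct answer. **Exponent.** Let $F$ be a field. An algebraic algorithm of rank $t$ for the product of two $n\times n$ matrices over $F$ consists of coefficients $\alpha_{ij\mu},\beta_{ij\mu},\lambda_{ij\mu}\in F$ with $1 \le i,j \le n$ and $1 \le \mu \le t$ such that $$(AB)[i,j]=\sum_{\mu=1}^{t}\lambda_{ij\mu}\Big(\sum_{i',j'}\alpha_{i'j'\mu}A[i',j']\Big)\Big(\sum_{i',j'}\beta_{i'j'\mu}B[j',i']\Big)$$ for all $A,B\in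 F^{n\times n}$ and all $i,j$. Let $\omega=\omega(F)$ be the least real $\tau$ such that, for every $\varepsilon>0$, products of two $n\times n$ matrices over $F$ have algebraic algorithms of rank $O(n^{\tau+\varepsilon})$. **Theorem.** Consider the problem of computing the number of edges in a maximum matching of a simple graph with $n$ vertices. 1. For every field $F$, its randomized round complexity in the congested clique is $O(n^{1-2/\omega+o(1)}\log n)$, that is, $O(n^{1-2/\omega+\varepsilon}\log n)$ for every $\varepsilon>0$. 2. If $F$ is finite and $\tau$ is a real number such that products of two $n\times n$ matrices over $F$ have algebraic algorithms of rank $O(n^{\tau})$, then its randomized round complexity in the congested clique is $O(n^{1-2/\tau}\log n)$; in particular it is $O(n^{1-2/\omega}\log n)$ if this holds with $\tau=\omega$. -/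

import Mathlib

open scoped BigOperators

/-! ### Maximum matchings -/

/-- The number of edges in a maximum matching of a graph (used for graphs on finitely many
vertices, where the supremum is over a finite nonempty set and hence a maximum). -/
noncomputable def matchingNumber {V : Type*} (G : SimpleGraph V) : ℕ :=
  sSup {k : ℕ | ∃ M : G.Subgraph, M.IsMatching ∧ M.edgeSet.ncard = k}

/-! ### Algebraic algorithms for matrix multiplication and the exponent `ω` -/

/-- An algebraic (bilinear) algorithm of rank `t` computing the product of an `n × m` matrix
by an `m × n` matrix over `F`. -/
structure AlgebraicAlgorithm (F : Type*) [Field F] (n m t : ℕ) where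
  /-- coefficients of the linear forms in the entries of the left factor -/
  α : Fin n → Fin m → Fin t → F
  /-- coefficients of the linear forms in the entries of the right factor -/
  β : Fin n → Fin m → Fin t → F
  /-- coefficients of the products in the entries of the result -/
  coeff : Fin n → Fin n → Fin t → F
  correct : ∀ (A : Matrix (Fin n) (Fin m) F) (B : Matrix (Fin m) (Fin n) F) (i j : Fin n),
    (A * B) i j = ∑ μ : Fin t, coeff i j μ *
      ((∑ i' : Fin n, ∑ j' : Fin m, α i' j' μ * A i' j') *
        (∑ i' : Fin n, ∑ j' : Fin m, β i' j' μ * B j' i'))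

/-- Products of two `n × n` matrices over `F` are computed by algebraic algorithms of rank
`O(n ^ τ)`. -/
def SquareProductRankO (F : Type*) [Field F] (τ : ℝ) : Prop :=
  ∃ C : ℝ, ∀ n : ℕ, 1 ≤ n →
    ∃ t : ℕ, (t : ℝ) ≤ C * (n : ℝ) ^ τ ∧ Nonempty (AlgebraicAlgorithm F n n t)

/-- The exponent `ω` of square matrix multiplication over `F`: the least `τ` such that products
of two `n × n` matrices are computed with rank `O(n ^ (τ + ε))` for every `ε > 0`. -/
noncomputable def omegaExponent (F : Type*) [Field F] : ℝ :=
  sInf {τ : ℝ | ∀ ε : ℝ, 0 < ε → SquareProductRankO F (τ + ε)}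

/-! ### The congested clique model -/

/-- A message: a word of `⌈log₂ n⌉` bits. -/
abbrev Message (n : ℕ) : Type := Fin (Nat.clog 2 n) → Bool

/-- A randomized protocol for the congested clique with `n` nodes, for problems whose input is a
graph on the node set. Every node initially knows its own name, the set of its neighbours in the
input graph (its row, equivalently its column, of the adjacency matrix) and a private seed. In
each synchronous round every node sends one message to each node, depending on the recipient.
Local computation is unrestricted. -/
structure CliqueProtocol (n : ℕ) (Out : Type) where
  /-- local states of the nodes -/
  State : Type
  /-- values of the private random seed of a node -/
  Seed : Type
  [fintypeSeed : Fintype Seed]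
  [nonemptySeed : Nonempty Seed]
  /-- `init v N s`: initial state of node `v` with set of neighbours `N` and seed `s` -/
  init : Fin n → Set (Fin n) → Seed → State
  /-- `send v q u`: message that node `v` in state `q` sends to node `u` -/
  send : Fin n → State → Fin n → Message n
  /-- `next v q r`: new state of node `v` in state `q` when `r u` is the message from `u` -/
  next : Fin n → State → (Fin n → Message n) → State
  /-- the value that a node outputs when it stops -/
  output : Fin n → State → Out

namespace CliqueProtocol

attribute [instance] CliqueProtocol.fintypeSeed CliqueProtocol.nonemptySeed

variable {n : ℕ} {Out : Type}

/-- The states of all the nodes after `T` rounds on input `G`, when the seed of `v` is `ρ v`. -/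
def run (P : CliqueProtocol n Out) (G : SimpleGraph (Fin n)) (ρ : Fin n → P.Seed) :
    ℕ → Fin n → P.State
  | 0 => fun v => P.init v (G.neighborSet v) (ρ v)
  | T + 1 => fun v => P.next v (P.run G ρ T v) (fun u => P.send u (P.run G ρ T u) v)

/-- The probability, over independent and uniformly distributed seeds of the nodes, that after
`T` rounds on input `G` every node outputs `a`. -/
noncomputable def successProb (P : CliqueProtocol n Out) (T : ℕ) (G : SimpleGraph (Fin n))
    (a : Out) : ℝ :=
  (Nat.card {ρ : Fin n → P.Seed // ∀ v, P.output v (P.run G ρ T v) = a} : ℝ) /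
    (Nat.card (Fin n → P.Seed) : ℝ)

end CliqueProtocol

/-- The randomized round complexity, in the congested clique, of the graph problem `f` is
`O(g n)`: for every exponent `c` there are protocols for all numbers `n` of nodes which stop
after `O(g n)` rounds and with which, on every input graph, all nodes output the correct answer
with probability at least `1 - 1 / n ^ c`. -/
def RandomizedRoundsO {Out : Type} (f : ∀ n : ℕ, SimpleGraph (Fin n) → Out) (g : ℕ → ℝ) : Prop :=
  ∀ c : ℕ, ∃ C : ℝ, ∀ n : ℕ, 2 ≤ n →
    ∃ (P : CliqueProtocol n Out) (T : ℕ), (T : ℝ) ≤ C * g n ∧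
      ∀ G : SimpleGraph (Fin n), 1 - 1 / (n : ℝ) ^ c ≤ P.successProb T G (f n G)

/-! Let `T` be the Tutte matrix of `G` with arbitrary weights and ν the matching number. Then `T`
has rank at most 2ν: an alternating matrix has a nonsingular principal submatrix of full rank, and
such a submatrix can be peeled off two indices at a time, each pair being an edge
(`NonsingularOn.exists_matching`). To read the rank off with few matrix products, multiply `T` by a
second random matrix `N` and form the Hankel matrix of the numbers 1ᵀ(TN)^k 1. It factors through `T
* N`, so its rank never exceeds 2ν. For suitable weights `T * N` is diagonal with 2ν distinct
nonzero entries, and a 2ν-minor is a product of Vandermonde determinants and a diagonal. By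
Schwartz–Zippel, over a field of polynomial size the rank is 2ν with high probability
(`le_prob_rank_hankel`).

Repeated squaring yields all vectors (TN)^k 1 with O(log n) products (`Reach.krylov`). One product
takes O(n^(1-2/τ)) rounds: cut the matrices into an m × m grid of blocks, with m of order n^(1/τ),
so that a bilinear algorithm uses at most n block products, one per node. Each node then handles
O((n/m)^2 + n) values per block matrix, and König's edge colouring routes them evenly
(`Reach.route`, `Reach.matMul`).

For a finite field `F` this runs over an extension of `F`. For general `F`, a single algorithm of
rank at most n₀^(ω+2ε) is reduced modulo a maximal ideal of the ring generated by its coefficients,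
which gives a finite residue field; Kronecker powers then recover all sizes
(`HasRank.exists_finite`, `HasRank.exists_bound`).

Protocols are handled through `Reach`, which records what each node can distinguish: a node can
compute anything that depends only on its knowledge. -/

/-! ### Knowledge in the congested clique -/

namespace CongestedClique

variable {n : ℕ} {S : Type}

/-- The global data that determine a run: the input graph and the seeds of all nodes. -/
abbrev Input (n : ℕ) (S : Type) : Type := SimpleGraph (Fin n) × (Fin n → S)

/-- A knowledge profile: `κ v a b` says that node `v` may be unable to tell `a` from `b`. -/
abbrev Profile (n : ℕ) (S : Type) : Type := Fin n → Input n S → Input n S → Prop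

/-- `g` is determined by the knowledge `r`. -/
def Known {Ω : Type*} {β : Sort*} (r : Ω → Ω → Prop) (g : Ω → β) : Prop :=
  ∀ a b, r a b → g a = g b

/-- The states of all the nodes after a number of rounds. -/
def states {State : Type} (init : Fin n → Set (Fin n) → S → State)
    (send : Fin n → State → Fin n → Message n)
    (next : Fin n → State → (Fin n → Message n) → State) (a : Input n S) : ℕ → Fin n → State
  | 0 => fun v => init v (a.1.neighborSet v) (a.2 v)
  | T + 1 => fun v => next v (states init send next a T v)
      (fun u => send u (states init send next a T u) v)

/-- Within `T` rounds every node `v` can learn enough to distinguish all inputs not related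
by `κ v`. -/
def Reach (T : ℕ) (κ : Profile n S) : Prop :=
  ∃ (State : Type) (init : Fin n → Set (Fin n) → S → State)
    (send : Fin n → State → Fin n → Message n)
    (next : Fin n → State → (Fin n → Message n) → State),
    ∀ v a b, states init send next a T v = states init send next b T v → κ v a b

/-- Turns `Known` into an actual function of the local state; this is where unrestricted local
computation enters. Values off the range of `f` are arbitrary. -/
theorem exists_factor {Ω A B : Type*} [Nonempty B] (f : Ω → A) (g : Ω → B)
    (h : ∀ a b, f a = f b → g a = g b) : ∃ φ : A → B, ∀ a, g a = φ (f a) := by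
  classical
  refine ⟨fun q => if h : ∃ a, f a = q then g h.choose else Classical.arbitrary B, fun a => ?_⟩
  have hex : ∃ b, f b = f a := ⟨a, rfl⟩
  simp only [hex, dif_pos]
  exact h _ _ hex.choose_spec.symm

theorem Reach.mono {T : ℕ} {κ κ' : Profile n S} (h : Reach T κ)
    (hκ : ∀ v a b, κ v a b → κ' v a b) : Reach T κ' := by
  obtain ⟨State, init, send, next, H⟩ := h
  exact ⟨State, init, send, next, fun v a b e => hκ _ _ _ (H v a b e)⟩

/-- Initially every node knows its neighbours and its seed. -/
theorem reach_zero :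
    Reach 0 (fun (v : Fin n) (a b : Input n S) =>
      a.1.neighborSet v = b.1.neighborSet v ∧ a.2 v = b.2 v) :=
  ⟨Set (Fin n) × S, fun _ N s => (N, s), fun _ _ _ _ => false, fun _ q _ => q,
    fun v a b e => by simpa [states] using e⟩

/-- A round counter in the state tells a node when to switch from the old messages to the new ones,
and the state keeps the last batch received. -/
theorem Reach.round {T : ℕ} {κ : Profile n S} (h : Reach T κ)
    (m : Fin n → Fin n → Input n S → Message n) (hm : ∀ u v, Known (κ u) (m u v)) :
    Reach (T + 1) (fun v a b => κ v a b ∧ ∀ u, m u v a = m u v b) := by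
  obtain ⟨State, init, send, next, H⟩ := h
  have hφ : ∀ u v, ∃ φ : State → Message n, ∀ a, m u v a = φ (states init send next a T u) :=
    fun u v => exists_factor _ _ fun a b e => hm u v a b (H u a b e)
  choose φ hφ using hφ
  let init' : Fin n → Set (Fin n) → S → ℕ × State × (Fin n → Message n) :=
    fun v N s => (0, init v N s, fun _ _ => false)
  let send' : Fin n → ℕ × State × (Fin n → Message n) → Fin n → Message n :=
    fun v q u => if q.1 < T then send v q.2.1 u else φ v u q.2.1
  let next' : Fin n → ℕ × State × (Fin n → Message n) → (Fin n → Message n) →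
      ℕ × State × (Fin n → Message n) :=
    fun v q r => if q.1 < T then (q.1 + 1, next v q.2.1 r, r) else (q.1 + 1, q.2.1, r)
  have key : ∀ a k, k ≤ T → ∀ v, (states init' send' next' a k v).1 = k ∧
      (states init' send' next' a k v).2.1 = states init send next a k v := by
    intro a k
    induction k with
    | zero => intro _ v; exact ⟨rfl, rfl⟩
    | succ k ih =>
      intro hk v
      have ih' := ih (by omega)
      have hlt : k < T := by omega
      simp [states, next', send', ih', hlt]
  refine ⟨_, init', send', next', fun v a b e => ?_⟩
  have hs : ∀ a, states init' send' next' a (T + 1) v =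
      (T + 1, states init send next a T v, fun u => m u v a) := by
    intro a
    have hk := key a T le_rfl
    simp [states, next', send', hk, hφ]
  rw [hs, hs] at e
  simp only [Prod.mk.injEq, true_and] at e
  exact ⟨H v a b e.1, fun u => congrFun e.2 u⟩

theorem Reach.rounds {T : ℕ} {κ : Profile n S} (h : Reach T κ) (R : ℕ)
    (m : ℕ → Fin n → Fin n → Input n S → Message n) (hm : ∀ r u v, Known (κ u) (m r u v)) :
    Reach (T + R) (fun v a b => κ v a b ∧ ∀ r < R, ∀ u, m r u v a = m r u v b) := by
  induction R with
  | zero => exact h.mono fun v a b hab => ⟨hab, by simp⟩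
  | succ R ih =>
    refine (ih.round (m R) fun u v a b hab => hm R u v a b hab.1).mono ?_
    rintro v a b ⟨⟨h1, h2⟩, h3⟩
    refine ⟨h1, fun r hr u => ?_⟩
    rcases Nat.lt_succ_iff_lt_or_eq.mp hr with h | rfl
    · exact h2 r h u
    · exact h3 u

theorem Reach.le {T T' : ℕ} {κ : Profile n S} (h : Reach T κ) (hT : T ≤ T') : Reach T' κ := by
  obtain ⟨R, rfl⟩ := Nat.exists_eq_add_of_le hT
  exact (h.rounds R (fun _ _ _ _ _ => false) fun _ _ _ _ _ _ => rfl).mono fun v a b hab => hab.1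

/-- Every ordered pair of nodes can exchange a value that is encoded in `R` messages. -/
theorem Reach.exchange {T R : ℕ} {κ : Profile n S} (h : Reach T κ) {W : Type*}
    (enc : W ↪ (Fin R → Message n)) (val : Fin n → Fin n → Input n S → W)
    (hval : ∀ u v, Known (κ u) (val u v)) :
    Reach (T + R) (fun v a b => κ v a b ∧ ∀ u, val u v a = val u v b) := by
  refine (h.rounds R
    (fun r u v a => if hr : r < R then enc (val u v a) ⟨r, hr⟩ else fun _ => false) ?_).mono ?_
  · intro r u v a b hab
    simp only [hval u v a b hab]
  · rintro v a b ⟨h1, h2⟩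
    refine ⟨h1, fun u => enc.injective (funext fun r => ?_)⟩
    simpa [r.2] using h2 r r.2 u

/-! ### Routing -/

/-- A regular bipartite multigraph has a proper edge colouring (König). -/
theorem exists_coloring_of_regular {V : Type*} [Fintype V] [DecidableEq V] (Δ : ℕ) :
    ∀ {M : Type} [Fintype M] (src dst : M → V),
      (∀ v, Fintype.card {m // src m = v} = Δ) → (∀ v, Fintype.card {m // dst m = v} = Δ) →
      ∃ col : M → Fin Δ, (Function.Injective fun m => (src m, col m)) ∧
        Function.Injective fun m => (dst m, col m) := by
  classical
  induction Δ with
  | zero =>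
    intro M _ src dst h1 _
    have : IsEmpty M := ⟨fun m => by
      have := Fintype.card_eq_zero_iff.mp (h1 (src m))
      exact this.false ⟨m, rfl⟩⟩
    exact ⟨fun m => isEmptyElim m, fun m => isEmptyElim m, fun m => isEmptyElim m⟩
  | succ Δ ih =>
    intro M _ src dst h1 h2
    have fib : ∀ (f : M → V), (∀ v, Fintype.card {m // f m = v} = Δ + 1) → ∀ A : Finset V,
        (Finset.univ.filter fun m => f m ∈ A).card = A.card * (Δ + 1) := by
      intro f hf A
      rw [Finset.card_eq_sum_card_fiberwise (f := f) (t := A) (by intro m; simp)]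
      rw [Finset.sum_congr rfl (g := fun _ => Δ + 1), Finset.sum_const, smul_eq_mul]
      intro v hv
      rw [← hf v, Fintype.card_subtype, Finset.filter_filter]
      congr 1
      ext m
      simp only [Finset.mem_filter, Finset.mem_univ, true_and, and_iff_right_iff_imp]
      rintro rfl; exact hv
    -- Hall's condition by counting: the `A.card * (Δ + 1)` edges leaving `A` all end in `B`, which
    -- receives `B.card * (Δ + 1)` edges.
    have hall := (Finset.all_card_le_biUnion_card_iff_exists_injective
      (fun v => (Finset.univ.filter fun m => src m = v).image dst)).mp (by
        intro A
        set B := A.biUnion fun v => (Finset.univ.filter fun m => src m = v).image dst with hB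
        have hsub : (Finset.univ.filter fun m => src m ∈ A) ⊆
            Finset.univ.filter fun m => dst m ∈ B := by
          intro m hm
          simp only [Finset.mem_filter, Finset.mem_univ, true_and] at hm ⊢
          exact Finset.mem_biUnion.mpr ⟨_, hm, Finset.mem_image.mpr ⟨m, by simp, rfl⟩⟩
        have := Finset.card_le_card hsub
        rw [fib src h1, fib dst h2] at this
        exact Nat.le_of_mul_le_mul_right this (Nat.succ_pos Δ))
    obtain ⟨f, hfi, hf⟩ := hall
    have hsel : ∀ v, ∃ m, src m = v ∧ dst m = f v := by
      intro v
      simpa using hf v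
    choose sel hs hd using hsel
    have hfs : Function.Surjective f := Finite.injective_iff_surjective.mp hfi
    -- Deleting the perfect matching `sel` lowers every degree by one; `w` lists the same edges by
    -- their endpoint under `g`, so this serves both sides.
    have sub : ∀ (g : M → V) (w : V → M), (∀ v, g (w v) = v) → Set.range w = Set.range sel →
        (∀ v, Fintype.card {m // g m = v} = Δ + 1) → ∀ v,
        Fintype.card {m : {m // m ∉ Set.range sel} // g m = v} = Δ := by
      intro g w hw hr hg v
      have e : {m : {m // m ∉ Set.range sel} // g m = v} ≃
          {x : {m // g m = v} // x ≠ ⟨w v, hw v⟩} :=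
        { toFun := fun m => ⟨⟨m.1.1, m.2⟩, fun hh => m.1.2 (by
            exact hr.subset ⟨v, (congrArg Subtype.val hh).symm⟩)⟩
          invFun := fun x => ⟨⟨x.1.1, fun hh => by
            rw [← hr] at hh
            obtain ⟨u, hu⟩ := hh
            apply x.2
            apply Subtype.ext
            have : u = v := by rw [← hw u, hu, x.1.2]
            rw [← hu, this]⟩, x.1.2⟩
          left_inv := fun _ => rfl
          right_inv := fun _ => rfl }
      rw [Fintype.card_congr e]
      have := Fintype.card_subtype_compl (fun x : {m // g m = v} => x = ⟨w v, hw v⟩)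
      rw [Fintype.card_subtype_eq, hg v] at this
      simpa using this
    let finv := Function.surjInv hfs
    obtain ⟨col, hc1, hc2⟩ := ih (M := {m // m ∉ Set.range sel}) (fun m => src m) (fun m => dst m)
      (sub src sel hs rfl h1)
      (sub dst (sel ∘ finv) (fun v => by simp [hd, finv, Function.surjInv_eq]) (by
        have : Function.Surjective finv := by
          intro v
          exact ⟨f v, hfi (Function.surjInv_eq hfs _)⟩
        rw [Set.range_comp, this.range_eq, Set.image_univ]) h2)
    refine ⟨fun m => if h : m ∈ Set.range sel then Fin.last Δ else (col ⟨m, h⟩).castSucc, ?_, ?_⟩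
    · intro m m' e
      simp only [Prod.mk.injEq] at e
      obtain ⟨e1, e2⟩ := e
      by_cases h : m ∈ Set.range sel <;> by_cases h' : m' ∈ Set.range sel
      · obtain ⟨u, rfl⟩ := h
        obtain ⟨u', rfl⟩ := h'
        rw [hs, hs] at e1; rw [e1]
      · simp only [h, h', dif_pos, dif_neg, not_false_eq_true] at e2
        exact absurd e2.symm (Fin.castSucc_lt_last _).ne
      · simp only [h, h', dif_pos, dif_neg, not_false_eq_true] at e2
        exact absurd e2 (Fin.castSucc_lt_last _).ne
      · simp only [h, h', dif_neg, not_false_eq_true] at e2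
        have := @hc1 ⟨m, h⟩ ⟨m', h'⟩ (Prod.ext e1 (Fin.castSucc_injective _ e2))
        exact congrArg Subtype.val this
    · intro m m' e
      simp only [Prod.mk.injEq] at e
      obtain ⟨e1, e2⟩ := e
      by_cases h : m ∈ Set.range sel <;> by_cases h' : m' ∈ Set.range sel
      · obtain ⟨u, rfl⟩ := h
        obtain ⟨u', rfl⟩ := h'
        rw [hd, hd] at e1; rw [hfi e1]
      · simp only [h, h', dif_pos, dif_neg, not_false_eq_true] at e2
        exact absurd e2.symm (Fin.castSucc_lt_last _).ne
      · simp only [h, h', dif_pos, dif_neg, not_false_eq_true] at e2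
        exact absurd e2 (Fin.castSucc_lt_last _).ne
      · simp only [h, h', dif_neg, not_false_eq_true] at e2
        have := @hc2 ⟨m, h⟩ ⟨m', h'⟩ (Prod.ext e1 (Fin.castSucc_injective _ e2))
        exact congrArg Subtype.val this

/-- A bipartite multigraph of maximum degree at most `Δ` has a proper edge colouring with
`Δ` colours (König). -/
theorem exists_coloring {V : Type} [Fintype V] [DecidableEq V] (Δ : ℕ) {M : Type} [Fintype M]
    (src dst : M → V) (h1 : ∀ v, Fintype.card {m // src m = v} ≤ Δ)
    (h2 : ∀ v, Fintype.card {m // dst m = v} ≤ Δ) :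
    ∃ col : M → Fin Δ, (Function.Injective fun m => (src m, col m)) ∧
      Function.Injective fun m => (dst m, col m) := by
  classical
  -- Dummy edges fill all degrees up to `Δ`. Both sides lack equally many, so any bijection between
  -- the missing ends makes the multigraph regular.
  let P (f : M → V) : Type := Σ v, Fin (Δ - Fintype.card {m // f m = v})
  have hsum : ∀ f : M → V, (∀ v, Fintype.card {m // f m = v} ≤ Δ) →
      Fintype.card (P f) + Fintype.card M = Fintype.card V * Δ := by
    intro f hf
    have e : Fintype.card M = ∑ v, Fintype.card {m // f m = v} := by
      rw [← Fintype.card_sigma]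
      exact Fintype.card_congr (Equiv.sigmaFiberEquiv f).symm
    simp only [P, Fintype.card_sigma, Fintype.card_fin]
    rw [e, ← Finset.sum_add_distrib, Finset.sum_congr rfl (g := fun _ => Δ)
      (fun v _ => Nat.sub_add_cancel (hf v))]
    simp
  have e : P src ≃ P dst := Fintype.equivOfCardEq (by
    have := hsum src h1; have := hsum dst h2; omega)
  have fib : ∀ (f : M → V) (Q : Type) [Fintype Q] (g : Q → V), (∀ v, Fintype.card {m // f m = v} ≤ Δ) →
      (∀ v, Fintype.card {q // g q = v} = Δ - Fintype.card {m // f m = v}) →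
      ∀ v, Fintype.card {x : M ⊕ Q // Sum.elim f g x = v} = Δ := by
    intro f Q _ g hf hg v
    have e : {x : M ⊕ Q // Sum.elim f g x = v} ≃ {m // f m = v} ⊕ {q // g q = v} :=
      Equiv.subtypeSum
    rw [← Nat.card_eq_fintype_card, Nat.card_congr e, Nat.card_sum, Nat.card_eq_fintype_card,
      Nat.card_eq_fintype_card, hg v, Nat.add_sub_cancel' (hf v)]
  have fibP : ∀ (f : M → V) (v : V), Fintype.card {q : P f // q.1 = v} =
      Δ - Fintype.card {m // f m = v} := by
    intro f v
    rw [Fintype.card_congr (Equiv.sigmaSubtype (β := fun v =>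
      Fin (Δ - Fintype.card {m // f m = v})) v), Fintype.card_fin]
  obtain ⟨col, hc1, hc2⟩ := exists_coloring_of_regular Δ
    (Sum.elim src fun q : P src => q.1) (Sum.elim dst fun q : P src => (e q).1)
    (fib src _ _ h1 (fibP src))
    (fib dst _ _ h2 fun v => by
      rw [← fibP dst v]
      exact Fintype.card_congr (e.subtypeEquiv fun q => Iff.rfl))
  refine ⟨fun m => col (.inl m), fun m m' h => ?_, fun m m' h => ?_⟩
  · exact Sum.inl_injective (hc1 (by simpa using h))
  · exact Sum.inl_injective (hc2 (by simpa using h))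

/-- Routing: if every node is the source and the destination of at most `L * n` values, each
encoded in `w` messages, then all of them can be delivered in `2 * (L * w)` rounds. -/
theorem Reach.route {T L w : ℕ} {κ : Profile n S} (h : Reach T κ) {W : Type} [Nonempty W]
    (enc : W ↪ (Fin w → Message n)) {M : Type} [Fintype M] (src dst : M → Fin n)
    (h1 : ∀ v, Fintype.card {m // src m = v} ≤ L * n)
    (h2 : ∀ v, Fintype.card {m // dst m = v} ≤ L * n)
    (val : M → Input n S → W) (hval : ∀ m, Known (κ (src m)) (val m)) :
    Reach (T + 2 * (L * w))
      (fun v a b => κ v a b ∧ ∀ m, dst m = v → val m a = val m b) := by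
  classical
  obtain ⟨col', hc1, hc2⟩ := exists_coloring (L * n) src dst h1 h2
  -- A colour is a slot together with a relay node. Properness at both ends means that an ordered
  -- pair of nodes carries at most `L` values in each of the two hops.
  let col : M → Fin L × Fin n := fun m => finProdFinEquiv.symm (col' m)
  have hcol : ∀ m m', col m = col m' → col' m = col' m' :=
    fun m m' e => finProdFinEquiv.symm.injective e
  have encL : Nonempty ((Fin L → W) ↪ (Fin (L * w) → Message n)) :=
    ⟨⟨fun f k => enc (f (finProdFinEquiv.symm k).1) (finProdFinEquiv.symm k).2, by
      intro f g e
      funext l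
      apply enc.injective
      funext k
      have := congrFun e (finProdFinEquiv (l, k))
      simpa using this⟩⟩
  obtain ⟨encL⟩ := encL
  let w0 : W := Classical.arbitrary W
  let val1 : Fin n → Fin n → Input n S → (Fin L → W) := fun u c ω l =>
    if h : ∃ m, src m = u ∧ col m = (l, c) then val h.choose ω else w0
  let val2 : Fin n → Fin n → Input n S → (Fin L → W) := fun c v ω l =>
    if h : ∃ m, dst m = v ∧ col m = (l, c) then val h.choose ω else w0
  have val1_eq : ∀ m ω, val1 (src m) (col m).2 ω (col m).1 = val m ω := by
    intro m ω
    have hex : ∃ m', src m' = src m ∧ col m' = ((col m).1, (col m).2) := ⟨m, rfl, rfl⟩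
    have : hex.choose = m :=
      hc1 (Prod.ext hex.choose_spec.1 (hcol _ _ hex.choose_spec.2))
    simp only [val1, hex, dif_pos, this]
  have val2_eq : ∀ m ω, val2 (col m).2 (dst m) ω (col m).1 = val m ω := by
    intro m ω
    have hex : ∃ m', dst m' = dst m ∧ col m' = ((col m).1, (col m).2) := ⟨m, rfl, rfl⟩
    have : hex.choose = m :=
      hc2 (Prod.ext hex.choose_spec.1 (hcol _ _ hex.choose_spec.2))
    simp only [val2, hex, dif_pos, this]
  have r1 := h.exchange encL val1 (by
    intro u c a b hab
    funext l
    simp only [val1]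
    split_ifs with hex
    · exact hval _ a b (by rw [hex.choose_spec.1]; exact hab)
    · rfl)
  have r2 := r1.exchange encL val2 (by
    rintro c v a b ⟨-, hab⟩
    funext l
    simp only [val2]
    split_ifs with hex
    · have hc := hex.choose_spec.2
      have := congrFun (hab (src hex.choose)) l
      have e := val1_eq hex.choose
      rw [hc] at e
      rw [← e, ← e, this]
    · rfl)
  have hT : T + L * w + L * w = T + 2 * (L * w) := by ring
  rw [hT] at r2
  refine r2.mono ?_
  rintro v a b ⟨⟨h1, -⟩, h3⟩
  refine ⟨h1, ?_⟩
  rintro m rfl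
  rw [← val2_eq, ← val2_eq m b, h3]

end CongestedClique

/-! ### Bilinear rank of matrix multiplication -/

namespace CongestedClique

/-- Products of `n × n` matrices have bilinear algorithms of rank `t` over the commutative ring
`R`, expressed by structure constants. -/
def HasRank (R : Type*) [CommRing R] (n t : ℕ) : Prop :=
  ∃ α β γ : Fin n → Fin n → Fin t → R, ∀ i j a b c d,
    ∑ μ, γ i j μ * (α a b μ * β c d μ) = if a = i ∧ b = d ∧ c = j then 1 else 0

/-- Matrix units extract the structure constants; `β c d` weighs the entry `(d, c)` of the right
factor, hence the transposed unit. -/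
theorem HasRank.of_algorithm {F : Type*} [Field F] {n t : ℕ} (P : AlgebraicAlgorithm F n n t) :
    HasRank F n t := by
  classical
  refine ⟨P.α, P.β, P.coeff, fun i j a b c d => ?_⟩
  have h := P.correct (Matrix.single a b 1) (Matrix.single d c 1) i j
  have e1 : ∀ μ, ∑ i', ∑ j', P.α i' j' μ * Matrix.single a b (1 : F) i' j' = P.α a b μ := by
    intro μ
    rw [Finset.sum_eq_single a, Finset.sum_eq_single b]
    · simp
    · intro x _ hx; simp [hx.symm]
    · simp
    · intro x _ hx; simp [hx.symm]
    · simp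
  have e2 : ∀ μ, ∑ i', ∑ j', P.β i' j' μ * Matrix.single d c (1 : F) j' i' = P.β c d μ := by
    intro μ
    rw [Finset.sum_eq_single c, Finset.sum_eq_single d]
    · simp
    · intro x _ hx; simp [hx.symm]
    · simp
    · intro x _ hx; simp [hx.symm]
    · simp
  simp only [e1, e2] at h
  rw [← h, Matrix.mul_apply, Finset.sum_eq_single b]
  · by_cases h1 : a = i <;> by_cases h2 : b = d <;> by_cases h3 : c = j <;>
      simp [h1, h2, h3, eq_comm]
  · intro x _ hx; simp [hx.symm]
  · simp

theorem HasRank.map {R R' : Type*} [CommRing R] [CommRing R'] (f : R →+* R') {n t : ℕ}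
    (h : HasRank R n t) : HasRank R' n t := by
  obtain ⟨α, β, γ, h⟩ := h
  refine ⟨fun i j μ => f (α i j μ), fun i j μ => f (β i j μ), fun i j μ => f (γ i j μ),
    fun i j a b c d => ?_⟩
  have := congrArg f (h i j a b c d)
  simpa [map_sum, apply_ite f] using this

theorem HasRank.of_map {R R' : Type*} [CommRing R] [CommRing R'] (f : R →+* R')
    (hf : Function.Injective f) {n t : ℕ} (α β γ : Fin n → Fin n → Fin t → R)
    (h : ∀ i j a b c d, ∑ μ, f (γ i j μ) * (f (α a b μ) * f (β c d μ)) =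
      if a = i ∧ b = d ∧ c = j then 1 else 0) : HasRank R n t := by
  refine ⟨α, β, γ, fun i j a b c d => hf ?_⟩
  have := h i j a b c d
  simpa [map_sum, apply_ite f] using this

theorem HasRank.restrict {R : Type*} [CommRing R] {n n' t : ℕ} (h : HasRank R n' t)
    (hn : n ≤ n') : HasRank R n t := by
  obtain ⟨α, β, γ, h⟩ := h
  refine ⟨fun i j => α (i.castLE hn) (j.castLE hn), fun i j => β (i.castLE hn) (j.castLE hn),
    fun i j => γ (i.castLE hn) (j.castLE hn), fun i j a b c d => ?_⟩
  rw [h]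
  simp only [(Fin.castLE_injective hn).eq_iff]

theorem hasRank_one (R : Type*) [CommRing R] : HasRank R 1 1 :=
  ⟨fun _ _ _ => 1, fun _ _ _ => 1, fun _ _ _ => 1, fun i j a b c d => by
    simp [Subsingleton.elim a i, Subsingleton.elim b d, Subsingleton.elim c j]⟩

/-- The Kronecker product of bilinear algorithms. -/
theorem HasRank.mul {R : Type*} [CommRing R] {n t n' t' : ℕ} (h : HasRank R n t)
    (h' : HasRank R n' t') : HasRank R (n * n') (t * t') := by
  obtain ⟨α, β, γ, h⟩ := h
  obtain ⟨α', β', γ', h'⟩ := h'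
  let e {x y : ℕ} : Fin (x * y) ≃ Fin x × Fin y := finProdFinEquiv.symm
  refine ⟨fun i j μ => α (e i).1 (e j).1 (e μ).1 * α' (e i).2 (e j).2 (e μ).2,
    fun i j μ => β (e i).1 (e j).1 (e μ).1 * β' (e i).2 (e j).2 (e μ).2,
    fun i j μ => γ (e i).1 (e j).1 (e μ).1 * γ' (e i).2 (e j).2 (e μ).2, fun i j a b c d => ?_⟩
  rw [← Equiv.sum_comp (e (x := t) (y := t')).symm]
  simp only [Equiv.apply_symm_apply]
  rw [Fintype.sum_prod_type]
  have key : ∀ i j a b c d (i' j' a' b' c' d'),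
      ∑ μ, ∑ μ', γ i j μ * γ' i' j' μ' * (α a b μ * α' a' b' μ' * (β c d μ * β' c' d' μ')) =
      (if a = i ∧ b = d ∧ c = j then 1 else 0) * (if a' = i' ∧ b' = d' ∧ c' = j' then 1 else 0) := by
    intro i j a b c d i' j' a' b' c' d'
    rw [← h, ← h', Finset.sum_mul_sum]
    exact Finset.sum_congr rfl fun μ _ => Finset.sum_congr rfl fun μ' _ => by ring
  rw [key, ite_zero_mul_ite_zero, mul_one]
  have he : ∀ x y : Fin (n * n'), x = y ↔ (e x).1 = (e y).1 ∧ (e x).2 = (e y).2 := fun x y => by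
    rw [← Prod.ext_iff, e.injective.eq_iff]
  simp only [he]
  congr 1
  simp only [eq_iff_iff]
  tauto

theorem HasRank.pow {R : Type*} [CommRing R] {n t : ℕ} (h : HasRank R n t) (k : ℕ) :
    HasRank R (n ^ k) (t ^ k) := by
  induction k with
  | zero => simpa using hasRank_one R
  | succ k ih => simpa [pow_succ] using ih.mul h

/-- The vectors `α a b` in `F ^ t` are independent: pairing with `γ i i * β i d` isolates the
coefficient at `(i, d)`. -/
theorem HasRank.sq_le {F : Type*} [Field F] {n t : ℕ} (h : HasRank F n t) : n * n ≤ t := by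
  classical
  obtain ⟨α, β, γ, h⟩ := h
  have hli : LinearIndependent F (fun p : Fin n × Fin n => α p.1 p.2) := by
    rw [Fintype.linearIndependent_iff]
    rintro x hx ⟨i, d⟩
    have h0 : ∀ μ, ∑ p : Fin n × Fin n, x p * α p.1 p.2 μ = 0 := fun μ => by
      simpa using congrFun hx μ
    have : ∑ μ, γ i i μ * β i d μ * ∑ p : Fin n × Fin n, x p * α p.1 p.2 μ = x (i, d) := by
      simp only [Finset.mul_sum]
      rw [Finset.sum_comm]
      have : ∀ p : Fin n × Fin n, ∑ μ, γ i i μ * β i d μ * (x p * α p.1 p.2 μ) =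
          x p * if p.1 = i ∧ p.2 = d ∧ i = i then 1 else 0 := by
        intro p
        rw [← h, Finset.mul_sum]
        exact Finset.sum_congr rfl fun μ _ => by ring
      simp only [this]
      rw [Finset.sum_eq_single (i, d)]
      · simp
      · rintro ⟨a, b⟩ _ hne
        have : ¬ (a = i ∧ b = d) := fun hh => hne (by rw [hh.1, hh.2])
        simp [this]
      · simp
    rw [← this]
    simp [h0]
  simpa using hli.fintype_card_le_finrank

theorem SquareProductRankO.exists_hasRank {F : Type*} [Field F] {τ : ℝ}
    (h : SquareProductRankO F τ) : ∃ C : ℝ, ∀ n : ℕ, 1 ≤ n →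
      ∃ t : ℕ, (t : ℝ) ≤ C * (n : ℝ) ^ τ ∧ HasRank F n t := by
  obtain ⟨C, hC⟩ := h
  refine ⟨C, fun n hn => ?_⟩
  obtain ⟨t, ht, ⟨P⟩⟩ := hC n hn
  exact ⟨t, ht, .of_algorithm P⟩

/-- The exponent of matrix multiplication is at least two. -/
theorem two_le_of_squareProductRankO {F : Type*} [Field F] {τ : ℝ}
    (h : SquareProductRankO F τ) : 2 ≤ τ := by
  obtain ⟨C, hC⟩ := SquareProductRankO.exists_hasRank h
  by_contra! hτ
  have htend : Filter.Tendsto (fun n : ℕ => (n : ℝ) ^ (2 - τ)) Filter.atTop Filter.atTop :=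
    (tendsto_rpow_atTop (by linarith)).comp tendsto_natCast_atTop_atTop
  obtain ⟨n, hn1, hn2⟩ := ((htend.eventually_gt_atTop C).and
    (Filter.eventually_ge_atTop 1)).exists
  obtain ⟨t, ht, hr⟩ := hC n hn2
  have hsq : ((n * n : ℕ) : ℝ) ≤ t := by exact_mod_cast hr.sq_le
  have hpos : (0 : ℝ) < n := by exact_mod_cast hn2
  have h1 : (n : ℝ) ^ (2 - τ) * (n : ℝ) ^ τ = ((n * n : ℕ) : ℝ) := by
    rw [← Real.rpow_add hpos]
    push_cast
    rw [sub_add_cancel]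
    norm_num [sq]
  have h2 : 0 < (n : ℝ) ^ τ := Real.rpow_pos_of_pos hpos _
  nlinarith

/-! ### Passing to a finite field -/

instance isJacobsonRing_int : IsJacobsonRing ℤ := by
  refine isJacobsonRing_iff_prime_eq.mpr fun P hP => ?_
  by_cases h0 : P = ⊥
  · subst h0
    refine le_antisymm (fun x hx => ?_) Ideal.le_jacobson
    -- Here `x * x + 1` is a unit of `ℤ`, hence `±1`, so `x = 0`.
    have h := Ideal.mem_jacobson_bot.mp hx x
    rw [Int.isUnit_iff] at h
    have : x * x = 0 := by rcases h with h | h <;> nlinarith [mul_self_nonneg x]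
    simpa using this
  · have := hP.isMaximal h0
    exact Ideal.jacobson_eq_self_of_isMaximal

/-- A field that is a finitely generated abelian group is finite. -/
theorem finite_of_module_finite_int (k : Type*) [Field k] [Module.Finite ℤ k] : Finite k := by
  obtain ⟨p, hp⟩ := CharP.exists k
  by_cases h0 : p = 0
  · subst h0
    have : CharZero k := CharP.charP_to_charZero k
    have : IsField ℤ := isField_of_isIntegral_of_isField
      (algebraMap ℤ k).injective_int (Field.toIsField k)
    exact absurd this Int.not_isField
  · refine Module.finite_of_fg_torsion k fun x => ?_
    exact ⟨⟨(p : ℤ), mem_nonZeroDivisors_of_ne_zero (by exact_mod_cast h0)⟩, by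
      simp [Submonoid.smul_def]⟩

/-- A bilinear algorithm over a field yields one of the same rank over some finite field. -/
theorem HasRank.exists_finite {F : Type*} [Field F] {n t : ℕ} (h : HasRank F n t) :
    ∃ (k : Type) (_ : Field k) (_ : Finite k), HasRank k n t := by
  classical
  obtain ⟨α, β, γ, h⟩ := h
  let c : (Fin n × Fin n × Fin t) ⊕ (Fin n × Fin n × Fin t) ⊕ (Fin n × Fin n × Fin t) → F :=
    Sum.elim (fun p => α p.1 p.2.1 p.2.2) (Sum.elim (fun p => β p.1 p.2.1 p.2.2)
      (fun p => γ p.1 p.2.1 p.2.2))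
  let R := Algebra.adjoin ℤ (Set.range c)
  have hft : Algebra.FiniteType ℤ R :=
    (Subalgebra.fg_iff_finiteType _).mp (Subalgebra.fg_def.mpr ⟨_, Set.finite_range c, rfl⟩)
  have hc : ∀ x, c x ∈ R := fun x => Algebra.subset_adjoin ⟨x, rfl⟩
  have hR : HasRank R n t := HasRank.of_map (R' := F) R.val.toRingHom Subtype.val_injective
    (fun i j μ => ⟨_, hc (.inl (i, j, μ))⟩) (fun i j μ => ⟨_, hc (.inr (.inl (i, j, μ)))⟩)
    (fun i j μ => ⟨_, hc (.inr (.inr (i, j, μ)))⟩) h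
  obtain ⟨I, hI⟩ := Ideal.exists_maximal R
  let _ : Field (R ⧸ I) := Ideal.Quotient.field I
  have hft' : Algebra.FiniteType ℤ (R ⧸ I) :=
    hft.of_surjective (Ideal.Quotient.mkₐ ℤ I) (Ideal.Quotient.mkₐ_surjective ℤ I)
  -- Nullstellensatz over the Jacobson ring `ℤ`.
  have hfin : Module.Finite ℤ (R ⧸ I) := finite_of_finite_type_of_isJacobsonRing ℤ _
  have hF : Finite (R ⧸ I) := finite_of_module_finite_int _
  obtain ⟨p, hp⟩ := CharP.exists (R ⧸ I)
  have : Fact p.Prime := ⟨CharP.char_is_prime (R ⧸ I) p⟩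
  -- The extension of degree one is a copy of the residue field in `Type`.
  exact ⟨FiniteField.Extension (R ⧸ I) p 1, inferInstance, inferInstance,
    (hR.map (Ideal.Quotient.mk I)).map (algebraMap _ _)⟩

end CongestedClique

/-! ### Distributed matrix multiplication -/

namespace CongestedClique

/-- Block matrix multiplication by a bilinear algorithm; `e` places the indices into blocks. -/
theorem block_mul {K : Type*} [CommRing K] {n m s t : ℕ} {α β γ : Fin m → Fin m → Fin t → K}
    (h : ∀ i j a b c d, ∑ μ, γ i j μ * (α a b μ * β c d μ) =
      if a = i ∧ b = d ∧ c = j then 1 else 0)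
    (e : Fin n ↪ Fin m × Fin s) (A B : Matrix (Fin n) (Fin n) K) (i j : Fin n) :
    (A * B) i j = ∑ μ, γ (e i).1 (e j).1 μ * ∑ c,
      (∑ p : Fin n × Fin n, if (e p.1).2 = (e i).2 ∧ (e p.2).2 = c then
        α (e p.1).1 (e p.2).1 μ * A p.1 p.2 else 0) *
      (∑ q : Fin n × Fin n, if (e q.1).2 = c ∧ (e q.2).2 = (e j).2 then
        β (e q.2).1 (e q.1).1 μ * B q.1 q.2 else 0) := by
  classical
  have h1 : ∀ μ, ∑ c,
      (∑ p : Fin n × Fin n, if (e p.1).2 = (e i).2 ∧ (e p.2).2 = c then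
        α (e p.1).1 (e p.2).1 μ * A p.1 p.2 else 0) *
      (∑ q : Fin n × Fin n, if (e q.1).2 = c ∧ (e q.2).2 = (e j).2 then
        β (e q.2).1 (e q.1).1 μ * B q.1 q.2 else 0) =
      ∑ p : Fin n × Fin n, ∑ q : Fin n × Fin n,
        if (e p.1).2 = (e i).2 ∧ (e p.2).2 = (e q.1).2 ∧ (e q.2).2 = (e j).2 then
          α (e p.1).1 (e p.2).1 μ * β (e q.2).1 (e q.1).1 μ * (A p.1 p.2 * B q.1 q.2) else 0 := by
    intro μ
    simp only [Finset.sum_mul_sum]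
    rw [Finset.sum_comm]
    refine Finset.sum_congr rfl fun p _ => ?_
    rw [Finset.sum_comm]
    refine Finset.sum_congr rfl fun q _ => ?_
    rw [Finset.sum_eq_single (e p.2).2]
    · simp only [eq_comm (a := (e q.1).2) (b := (e p.2).2)]
      by_cases c1 : (e p.1).2 = (e i).2 <;> by_cases c2 : (e p.2).2 = (e q.1).2 <;>
        by_cases c3 : (e q.2).2 = (e j).2 <;> simp [c1, c2, c3]
      ring
    · intro c _ hc
      rw [if_neg (fun hh => hc hh.2.symm), zero_mul]
    · simp
  simp only [h1]
  simp only [Finset.mul_sum]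
  rw [Finset.sum_comm, Matrix.mul_apply]
  have h2 : ∀ p q : Fin n × Fin n, ∑ μ, γ (e i).1 (e j).1 μ *
        (if (e p.1).2 = (e i).2 ∧ (e p.2).2 = (e q.1).2 ∧ (e q.2).2 = (e j).2 then
          α (e p.1).1 (e p.2).1 μ * β (e q.2).1 (e q.1).1 μ * (A p.1 p.2 * B q.1 q.2) else 0) =
      if p.1 = i ∧ p.2 = q.1 ∧ q.2 = j then A p.1 p.2 * B q.1 q.2 else 0 := by
    intro p q
    have he : ∀ x y : Fin n, x = y ↔ (e x).1 = (e y).1 ∧ (e x).2 = (e y).2 := fun x y => by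
      rw [← Prod.ext_iff, e.injective.eq_iff]
    split_ifs with c1 c2 c2
    · have := h (e i).1 (e j).1 (e p.1).1 (e p.2).1 (e q.2).1 (e q.1).1
      rw [if_pos ⟨congrArg (fun x => (e x).1) c2.1, congrArg (fun x => (e x).1) c2.2.1,
        congrArg (fun x => (e x).1) c2.2.2⟩] at this
      conv_rhs => rw [← one_mul (A p.1 p.2 * B q.1 q.2), ← this, Finset.sum_mul]
      exact Finset.sum_congr rfl fun μ _ => by ring
    · have := h (e i).1 (e j).1 (e p.1).1 (e p.2).1 (e q.2).1 (e q.1).1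
      rw [if_neg (by
        rintro ⟨d1, d2, d3⟩
        exact c2 ⟨(he _ _).mpr ⟨d1, c1.1⟩, (he _ _).mpr ⟨d2, c1.2.1⟩, (he _ _).mpr ⟨d3, c1.2.2⟩⟩)]
        at this
      conv_rhs => rw [← zero_mul (A p.1 p.2 * B q.1 q.2), ← this, Finset.sum_mul]
      exact Finset.sum_congr rfl fun μ _ => by ring
    · exact absurd ⟨congrArg (fun x => (e x).2) c2.1, congrArg (fun x => (e x).2) c2.2.1,
        congrArg (fun x => (e x).2) c2.2.2⟩ c1
    · simp
  have h3 : ∀ p : Fin n × Fin n, ∑ μ, ∑ q : Fin n × Fin n, γ (e i).1 (e j).1 μ *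
        (if (e p.1).2 = (e i).2 ∧ (e p.2).2 = (e q.1).2 ∧ (e q.2).2 = (e j).2 then
          α (e p.1).1 (e p.2).1 μ * β (e q.2).1 (e q.1).1 μ * (A p.1 p.2 * B q.1 q.2) else 0) =
      if p.1 = i then A p.1 p.2 * B p.2 j else 0 := by
    intro p
    rw [Finset.sum_comm]
    simp only [h2]
    rw [Finset.sum_eq_single (p.2, j)]
    · simp
    · intro q _ hq
      rw [if_neg]
      rintro ⟨-, d2, d3⟩
      exact hq (Prod.ext d2.symm d3)
    · simp
  simp only [h3]
  simp only [Fintype.sum_prod_type]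
  simp

theorem card_fiber_le {X V Y : Type*} [Fintype X] [DecidableEq V] [Fintype Y] (f : X → V)
    (g : X → Y) (h : Function.Injective fun x => (f x, g x)) (v : V) :
    Fintype.card {x // f x = v} ≤ Fintype.card Y :=
  Fintype.card_le_of_injective (fun x : {x // f x = v} => g x.1) fun x y hxy =>
    Subtype.ext (h (Prod.ext (x.2.trans y.2.symm) hxy))

variable {n : ℕ} {S : Type}

theorem Known.sum {Ω K ι : Type*} [AddCommMonoid K] {r : Ω → Ω → Prop} {s : Finset ι}
    {f : ι → Ω → K} (h : ∀ i ∈ s, Known r (f i)) : Known r (fun ω => ∑ i ∈ s, f i ω) :=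
  fun a b hab => Finset.sum_congr rfl fun i hi => h i hi a b hab

theorem Known.mul {Ω K : Type*} [Mul K] {r : Ω → Ω → Prop} {f g : Ω → K} (hf : Known r f)
    (hg : Known r g) : Known r (fun ω => f ω * g ω) :=
  fun a b hab => congrArg₂ _ (hf a b hab) (hg a b hab)

theorem Known.const {Ω K : Type*} {r : Ω → Ω → Prop} (c : K) : Known r (fun _ : Ω => c) :=
  fun _ _ _ => rfl

theorem Known.ite {Ω K : Type*} {r : Ω → Ω → Prop} {p : Prop} [Decidable p] {f g : Ω → K}
    (hf : p → Known r f) (hg : ¬ p → Known r g) : Known r (fun ω => if p then f ω else g ω) := by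
  by_cases hp : p
  · simpa [hp] using hf hp
  · simpa [hp] using hg hp

/-- The product of two distributed matrices, of which every node knows one row. -/
theorem Reach.matMul {T w m t s L : ℕ} {κ : Profile n S} (h : Reach T κ) {K : Type} [Field K]
    (enc : K ↪ (Fin w → Message n)) (hr : HasRank K m t) (ht : t ≤ n)
    (e : Fin n ↪ Fin m × Fin s) (g : Fin s × Fin s ↪ Fin L × Fin n) (hL : L * (m * m) ≤ 5 * n)
    (A B : Input n S → Matrix (Fin n) (Fin n) K) (hA : ∀ v, Known (κ v) (fun ω => A ω v))
    (hB : ∀ v, Known (κ v) (fun ω => B ω v)) :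
    Reach (T + (30 * w + 6 * (L * w)))
      (fun v a b => κ v a b ∧ (A a * B a) v = (A b * B b) v) := by
  classical
  obtain ⟨α, β, γ, hid⟩ := hr
  -- One node holds a given inner position of all `m * m` blocks, so every linear combination of
  -- blocks is formed locally at that position.
  let hold : Fin n × Fin n → Fin n := fun p => (g ((e p.1).2, (e p.2).2)).2
  have f1 : ∀ v, Fintype.card {p : Fin n × Fin n // p.1 = v} ≤ 5 * n := fun v =>
    (card_fiber_le (fun p : Fin n × Fin n => p.1) (fun p => p.2) (fun _ _ h => h) v).trans
      (by rw [Fintype.card_fin]; omega)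
  have f2 : ∀ v, Fintype.card {p : Fin n × Fin n // hold p = v} ≤ 5 * n := fun v => by
    refine (card_fiber_le hold (fun p : Fin n × Fin n =>
      ((g ((e p.1).2, (e p.2).2)).1, (e p.1).1, (e p.2).1)) ?_ v).trans (by simpa using hL)
    intro p q hpq
    simp only [Prod.mk.injEq] at hpq
    obtain ⟨c1, c2, c3, c4⟩ := hpq
    have := g.injective (Prod.ext c2 c1)
    simp only [Prod.mk.injEq] at this
    exact Prod.ext (e.injective (Prod.ext c3 this.1)) (e.injective (Prod.ext c4 this.2))
  let own : (Fin s × Fin s) × Fin t → Fin n := fun x => (g x.1).2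
  let node : (Fin s × Fin s) × Fin t → Fin n := fun x => x.2.castLE ht
  have f3 : ∀ v, Fintype.card {x // own x = v} ≤ L * n := fun v => by
    refine (card_fiber_le own (fun x => ((g x.1).1, x.2)) ?_ v).trans
      (by simpa using Nat.mul_le_mul_left L ht)
    intro x y hxy
    simp only [Prod.mk.injEq] at hxy
    exact Prod.ext (g.injective (Prod.ext hxy.2.1 hxy.1)) hxy.2.2
  have f4 : ∀ v, Fintype.card {x // node x = v} ≤ L * n := fun v => by
    refine (card_fiber_le node (fun x => g x.1) ?_ v).trans (by simp)
    intro x y hxy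
    simp only [Prod.mk.injEq] at hxy
    exact Prod.ext (g.injective hxy.2) (Fin.castLE_injective ht hxy.1)
  let P : Fin t → Fin s → Fin s → Input n S → K := fun μ a c ω =>
    ∑ p : Fin n × Fin n, if (e p.1).2 = a ∧ (e p.2).2 = c then
        α (e p.1).1 (e p.2).1 μ * A ω p.1 p.2 else 0
  let Q : Fin t → Fin s → Fin s → Input n S → K := fun μ c b ω =>
    ∑ q : Fin n × Fin n, if (e q.1).2 = c ∧ (e q.2).2 = b then
        β (e q.2).1 (e q.1).1 μ * B ω q.1 q.2 else 0
  let R : Fin t → Fin s → Fin s → Input n S → K := fun μ a b ω => ∑ c, P μ a c ω * Q μ c b ω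
  have r1 := h.route enc (fun p : Fin n × Fin n => p.1) hold f1 f2 (fun p ω => A ω p.1 p.2)
    fun p a b hab => congrFun (hA _ a b hab) _
  have r2 := r1.route enc (fun p : Fin n × Fin n => p.1) hold f1 f2 (fun p ω => B ω p.1 p.2)
    fun p a b hab => congrFun (hB _ a b hab.1) _
  have r3 := r2.route enc own node f3 f4 (fun x ω => P x.2 x.1.1 x.1.2 ω) (by
    intro x
    refine Known.sum fun p _ => Known.ite (fun hp => (Known.const _).mul ?_) fun _ => .const _
    intro a b hab
    refine hab.1.2 p ?_
    change (g ((e p.1).2, (e p.2).2)).2 = (g x.1).2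
    rw [hp.1, hp.2])
  have r4 := r3.route enc own node f3 f4 (fun x ω => Q x.2 x.1.1 x.1.2 ω) (by
    intro x
    refine Known.sum fun p _ => Known.ite (fun hp => (Known.const _).mul ?_) fun _ => .const _
    intro a b hab
    refine hab.1.2 p ?_
    change (g ((e p.1).2, (e p.2).2)).2 = (g x.1).2
    rw [hp.1, hp.2])
  have r5 := r4.route enc node own f4 f3 (fun x ω => R x.2 x.1.1 x.1.2 ω) (by
    intro x
    refine Known.sum fun c _ => Known.mul ?_ ?_
    · exact fun a b hab => hab.1.2 ((x.1.1, c), x.2) rfl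
    · exact fun a b hab => hab.2 ((c, x.1.2), x.2) rfl)
  have r6 := r5.route enc hold (fun p : Fin n × Fin n => p.1) f2 f1
    (fun p ω => (A ω * B ω) p.1 p.2) (by
      intro p
      simp only [block_mul hid e]
      refine Known.sum fun μ _ => (Known.const _).mul ?_
      exact fun a b hab => hab.2 (((e p.1).2, (e p.2).2), μ) rfl)
  have hT : T + 2 * (5 * w) + 2 * (5 * w) + 2 * (L * w) + 2 * (L * w) + 2 * (L * w) +
      2 * (5 * w) = T + (30 * w + 6 * (L * w)) := by ring
  rw [hT] at r6
  refine r6.mono fun v a b hab => ⟨hab.1.1.1.1.1.1, ?_⟩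
  funext j
  exact hab.2 (v, j) rfl

/-- A bilinear algorithm of rank at most `n` for `m × m` matrices yields the distributed product
of `n × n` matrices in `O(n / m ^ 2 + 1)` rounds. -/
theorem Reach.matMul_of_hasRank {T w m t : ℕ} {κ : Profile n S} (h : Reach T κ) {K : Type}
    [Field K] (enc : K ↪ (Fin w → Message n)) (hr : HasRank K m t) (hm : 1 ≤ m) (ht : t ≤ n)
    (A B : Input n S → Matrix (Fin n) (Fin n) K) (hA : ∀ v, Known (κ v) (fun ω => A ω v))
    (hB : ∀ v, Known (κ v) (fun ω => B ω v)) :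
    Reach (T + 36 * w * ((n / m + 1) ^ 2 / n + 1))
      (fun v a b => κ v a b ∧ (A a * B a) v = (A b * B b) v) := by
  have hmm : m * m ≤ n := hr.sq_le.trans ht
  have hn : 0 < n := lt_of_lt_of_le (Nat.mul_pos hm hm) hmm
  set s := n / m + 1 with hs
  set L := s ^ 2 / n + 1 with hLdef
  have hns : n ≤ m * s := by
    rw [hs, mul_add, mul_one]
    have := Nat.div_add_mod n m
    have := Nat.mod_lt n hm
    omega
  have hms : m * s ≤ 2 * n := by
    rw [hs, mul_add, mul_one]
    have := Nat.mul_div_le n m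
    nlinarith
  have hsL : s * s ≤ L * n := by
    have := Nat.div_add_mod (s ^ 2) n
    have := Nat.mod_lt (s ^ 2) hn
    rw [hLdef]
    nlinarith
  -- The quotient in `L` contributes `4 * n`, because rounding gives `m * s ≤ 2 * n`; the extra one
  -- contributes `m * m ≤ n`.
  have hL : L * (m * m) ≤ 5 * n := by
    have h1 : s ^ 2 / n * (m * m) ≤ 4 * n := by
      have h2 : s ^ 2 / n * n ≤ s ^ 2 := Nat.div_mul_le_self _ _
      refine Nat.le_of_mul_le_mul_right ?_ hn
      calc s ^ 2 / n * (m * m) * n = s ^ 2 / n * n * (m * m) := by ring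
        _ ≤ s ^ 2 * (m * m) := Nat.mul_le_mul_right _ h2
        _ = (m * s) ^ 2 := by ring
        _ ≤ (2 * n) ^ 2 := Nat.pow_le_pow_left hms 2
        _ = 4 * n * n := by ring
    rw [hLdef]
    nlinarith
  have e : Nonempty (Fin n ↪ Fin m × Fin s) :=
    Function.Embedding.nonempty_of_card_le (by simpa using hns)
  have g : Nonempty (Fin s × Fin s ↪ Fin L × Fin n) :=
    Function.Embedding.nonempty_of_card_le (by simpa using hsL)
  obtain ⟨e⟩ := e
  obtain ⟨g⟩ := g
  refine (h.matMul enc hr ht e g hL A B hA hB).le ?_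
  have : 1 ≤ L := Nat.le_add_left 1 _
  nlinarith

end CongestedClique

/-! ### The rank of alternating matrices and matchings -/

namespace CongestedClique

open Matrix

/-! ### Matchings in finite graphs -/

theorem verts_ncard_of_isMatching {V : Type*} [Fintype V] {G : SimpleGraph V} {M : G.Subgraph}
    (hM : M.IsMatching) : M.verts.ncard = 2 * M.edgeSet.ncard := by
  classical
  have h := M.spanningCoe.sum_degrees_eq_twice_card_edges
  have h1 : ∀ v, M.spanningCoe.degree v = if v ∈ M.verts then 1 else 0 := by
    intro v
    rw [SimpleGraph.Subgraph.degree_spanningCoe]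
    split_ifs with hv
    · exact SimpleGraph.Subgraph.isMatching_iff_forall_degree.mp hM v hv
    · exact SimpleGraph.Subgraph.degree_of_notMem_verts hv
  simp only [h1, Finset.sum_boole] at h
  rw [Set.ncard_eq_toFinset_card', Set.ncard_eq_toFinset_card']
  rw [Nat.cast_id] at h
  convert h using 2
  · ext v; simp
  · congr 1; ext e; simp

theorem bddAbove_matching {V : Type*} [Fintype V] (G : SimpleGraph V) :
    BddAbove {k : ℕ | ∃ M : G.Subgraph, M.IsMatching ∧ M.edgeSet.ncard = k} := by
  refine ⟨Fintype.card V, ?_⟩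
  rintro k ⟨M, hM, rfl⟩
  have h1 := verts_ncard_of_isMatching hM
  have h2 : M.verts.ncard ≤ Fintype.card V := by
    rw [← Nat.card_eq_fintype_card]; exact Set.ncard_le_card _
  omega

theorem le_matchingNumber {V : Type*} [Fintype V] {G : SimpleGraph V} {M : G.Subgraph}
    (hM : M.IsMatching) : M.edgeSet.ncard ≤ matchingNumber G :=
  le_csSup (bddAbove_matching G) ⟨M, hM, rfl⟩

theorem exists_maximum_matching {V : Type*} [Fintype V] (G : SimpleGraph V) :
    ∃ M : G.Subgraph, M.IsMatching ∧ M.edgeSet.ncard = matchingNumber G :=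
  Nat.sSup_mem (s := {k : ℕ | ∃ M : G.Subgraph, M.IsMatching ∧ M.edgeSet.ncard = k})
    ⟨_, ⊥, by intro v hv; exact hv.elim, rfl⟩ (bddAbove_matching G)

/-! ### Alternating matrices -/

variable {V K : Type*} [Fintype V] [Field K]

theorem dotProduct_sub_transpose_mulVec (U : Matrix V V K) (y z : V → K) :
    z ⬝ᵥ ((U - Uᵀ) *ᵥ y) = -(y ⬝ᵥ ((U - Uᵀ) *ᵥ z)) := by
  simp only [sub_mulVec, dotProduct_sub, mulVec_transpose]
  rw [dotProduct_mulVec y, dotProduct_mulVec z, dotProduct_comm (y ᵥ* U), dotProduct_comm (z ᵥ* U),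
    dotProduct_comm z, dotProduct_comm y]
  simp only [dotProduct_comm]
  ring

/-- The form `U - Uᵀ` makes this hold in characteristic two as well, where skew-symmetry alone would
not suffice. -/
theorem dotProduct_sub_transpose_mulVec_self (U : Matrix V V K) (y : V → K) :
    y ⬝ᵥ ((U - Uᵀ) *ᵥ y) = 0 := by
  rw [sub_mulVec, dotProduct_sub, mulVec_transpose, dotProduct_mulVec, dotProduct_comm, sub_self]

variable [DecidableEq V]

/-- The principal submatrix of `A` with index set `s` is nonsingular. -/
def NonsingularOn (A : Matrix V V K) (s : Finset V) : Prop :=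
  ∀ y : V → K, (∀ v ∉ s, y v = 0) → (∀ v ∈ s, (A *ᵥ y) v = 0) → y = 0

theorem NonsingularOn.exists_solution {A : Matrix V V K} {s : Finset V} (h : NonsingularOn A s)
    {i : V} (hi : i ∈ s) :
    ∃ z : V → K, (∀ v ∉ s, z v = 0) ∧ ∀ v ∈ s, (A *ᵥ z) v = if v = i then 1 else 0 := by
  -- The submatrix padded by the identity outside `s`: it is injective, hence surjective.
  let B : Matrix V V K := fun v u => if v ∈ s then (if u ∈ s then A v u else 0) else
    if u = v then 1 else 0
  have hB : ∀ (y : V → K), (∀ v ∉ s, y v = 0) → ∀ v ∈ s, (B *ᵥ y) v = (A *ᵥ y) v := by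
    intro y hy v hv
    simp only [mulVec, dotProduct, B, hv, if_true]
    refine Finset.sum_congr rfl fun u _ => ?_
    by_cases hu : u ∈ s <;> simp [hu, hy]
  have hB' : ∀ (y : V → K), ∀ v ∉ s, (B *ᵥ y) v = y v := by
    intro y v hv
    simp [mulVec, dotProduct, B, hv]
  have hinj : Function.Injective (B.mulVecLin) := by
    rw [← LinearMap.ker_eq_bot, LinearMap.ker_eq_bot']
    intro y hy
    have hy0 : ∀ v ∉ s, y v = 0 := fun v hv => by
      rw [← hB' y v hv]; exact congrFun hy v
    exact h y hy0 fun v hv => by rw [← hB y hy0 v hv]; exact congrFun hy v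
  obtain ⟨z, hz⟩ := LinearMap.injective_iff_surjective.mp hinj (Pi.single i 1)
  have hz0 : ∀ v ∉ s, z v = 0 := fun v hv => by
    rw [← hB' z v hv]
    have := congrFun hz v
    rw [mulVecLin_apply] at this
    rw [this, Pi.single_eq_of_ne]
    rintro rfl; exact hv hi
  refine ⟨z, hz0, fun v hv => ?_⟩
  rw [← hB z hz0 v hv]
  have := congrFun hz v
  rw [mulVecLin_apply] at this
  rw [this, Pi.single_apply]

/-- A nonsingular principal submatrix of an alternating matrix supported on the edges of a graph
gives a perfect matching of its index set. -/
theorem NonsingularOn.exists_matching {U : Matrix V V K} {G : SimpleGraph V}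
    (hG : ∀ i j, (U - Uᵀ) i j ≠ 0 → G.Adj i j) :
    ∀ (k : ℕ) (s : Finset V), s.card = k → NonsingularOn (U - Uᵀ) s →
      ∃ M : G.Subgraph, M.IsMatching ∧ M.verts = s := by
  intro k
  induction k using Nat.strong_induction_on with
  | _ k ih =>
  intro s hs h
  set A := U - Uᵀ with hA
  rcases s.eq_empty_or_nonempty with rfl | ⟨i, hi⟩
  · exact ⟨⊥, by intro v hv; exact hv.elim, by simp⟩
  have dot : ∀ (i : V), i ∈ s → ∀ y z : V → K, (∀ v ∉ s, y v = 0) →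
      (∀ v ∈ s, (A *ᵥ z) v = if v = i then 1 else 0) → y ⬝ᵥ (A *ᵥ z) = y i := by
    intro i hi y z hy hz
    rw [dotProduct, Finset.sum_eq_single i]
    · rw [hz i hi]; simp
    · intro v _ hv
      by_cases hvs : v ∈ s
      · rw [hz v hvs, if_neg hv, mul_zero]
      · rw [hy v hvs, zero_mul]
    · simp
  -- `z` is column `i` of the inverse on `s`. As `(A z) i = 1`, some `j` has `A i j` and `z j` both
  -- nonzero: the first gives an edge, the second keeps the submatrix nonsingular after deleting `i`
  -- and `j`.
  obtain ⟨z, hz0, hz⟩ := h.exists_solution hi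
  obtain ⟨j, hj1⟩ : ∃ j, A i j * z j ≠ 0 := by
    by_contra! hc
    have := hz i hi
    simp [mulVec, dotProduct, hc] at this
  have hAij : A i j ≠ 0 := left_ne_zero_of_mul hj1
  have hzj : z j ≠ 0 := right_ne_zero_of_mul hj1
  have hadj : G.Adj i j := hG i j hAij
  have hjs : j ∈ s := by by_contra hc; exact hzj (hz0 j hc)
  have hij : i ≠ j := hadj.ne
  obtain ⟨z', hz0', hz'⟩ := h.exists_solution hjs
  -- The inverse is alternating too: its diagonal vanishes and `z' i = -z j`.
  have hzi : z i = 0 := by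
    rw [← dot i hi z z hz0 hz]; exact dotProduct_sub_transpose_mulVec_self U z
  have hzj' : z' j = 0 := by
    rw [← dot j hjs z' z' hz0' hz']; exact dotProduct_sub_transpose_mulVec_self U z'
  have hzi' : z' i ≠ 0 := by
    rw [← dot i hi z' z hz0' hz, hA, dotProduct_sub_transpose_mulVec, ← hA, dot j hjs z z' hz0 hz']
    exact neg_ne_zero.mpr hzj
  set s' := (s.erase i).erase j with hs'
  have hmem : ∀ v, v ∈ s' ↔ v ∈ s ∧ v ≠ i ∧ v ≠ j := by
    intro v; simp only [hs', Finset.mem_erase]; tauto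
  have hcard : s'.card < k := by
    rw [← hs]
    exact Finset.card_lt_card ⟨fun v hv => ((hmem v).mp hv).1, fun hc =>
      ((hmem i).mp (hc hi)).2.1 rfl⟩
  have hns : NonsingularOn A s' := by
    intro y hy0 hy
    have hys : ∀ v ∉ s, y v = 0 := fun v hv => hy0 v fun hc => hv ((hmem v).mp hc).1
    have expand : ∀ w : V → K, (∀ v ∉ s, w v = 0) →
        w ⬝ᵥ (A *ᵥ y) = w i * (A *ᵥ y) i + w j * (A *ᵥ y) j := by
      intro w hw
      rw [dotProduct, ← Finset.sum_pair (f := fun v => w v * (A *ᵥ y) v) hij]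
      symm
      refine Finset.sum_subset (Finset.subset_univ _) fun v _ hv => ?_
      simp only [Finset.mem_insert, Finset.mem_singleton, not_or] at hv
      by_cases hvs : v ∈ s
      · rw [hy v ((hmem v).mpr ⟨hvs, hv⟩), mul_zero]
      · rw [hw v hvs, zero_mul]
    -- Pairing `z` with `A y` leaves only this term; by skew-symmetry it equals `-y i = 0`.
    have e1 : z j * (A *ᵥ y) j = 0 := by
      have := expand z hz0
      rw [hzi, zero_mul, zero_add, hA, dotProduct_sub_transpose_mulVec, ← hA,
        dot i hi y z hys hz, hy0 i (fun hc => ((hmem i).mp hc).2.1 rfl), neg_zero] at this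
      exact this.symm
    have e2 : z' i * (A *ᵥ y) i = 0 := by
      have := expand z' hz0'
      rw [hzj', zero_mul, add_zero, hA, dotProduct_sub_transpose_mulVec, ← hA,
        dot j hjs y z' hys hz', hy0 j (fun hc => ((hmem j).mp hc).2.2 rfl), neg_zero] at this
      exact this.symm
    refine h y hys fun v hv => ?_
    by_cases hvi : v = i
    · rw [hvi]; exact (mul_eq_zero.mp e2).resolve_left hzi'
    · by_cases hvj : v = j
      · rw [hvj]; exact (mul_eq_zero.mp e1).resolve_left hzj
      · exact hy v ((hmem v).mpr ⟨hv, hvi, hvj⟩)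
  obtain ⟨M, hM, hMv⟩ := ih _ hcard s' rfl hns
  have hM2 := SimpleGraph.Subgraph.IsMatching.subgraphOfAdj hadj
  refine ⟨M ⊔ G.subgraphOfAdj hadj, hM.sup hM2 ?_, ?_⟩
  · rw [hM.support_eq_verts, hM2.support_eq_verts, hMv, Set.disjoint_left]
    intro v hv hv2
    have := (hmem v).mp hv
    simp only [SimpleGraph.subgraphOfAdj_verts, Set.mem_insert_iff, Set.mem_singleton_iff] at hv2
    rcases hv2 with hv2 | hv2
    · exact this.2.1 hv2
    · exact this.2.2 hv2
  · ext v
    simp only [SimpleGraph.Subgraph.verts_sup, hMv, SimpleGraph.subgraphOfAdj_verts,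
      Set.mem_union, Finset.mem_coe, hmem, Set.mem_insert_iff, Set.mem_singleton_iff]
    constructor
    · rintro (h | rfl | rfl)
      · exact h.1
      · exact hi
      · exact hjs
    · intro hv
      by_cases hvi : v = i
      · exact .inr (.inl hvi)
      · by_cases hvj : v = j
        · exact .inr (.inr hvj)
        · exact .inl ⟨hv, hvi, hvj⟩

/-- An alternating matrix has a nonsingular principal submatrix of full rank. -/
theorem exists_nonsingularOn (U : Matrix V V K) :
    ∃ s : Finset V, s.card = (U - Uᵀ).rank ∧ NonsingularOn (U - Uᵀ) s := by
  set A := U - Uᵀ with hA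
  obtain ⟨b, -, -, hspan, hli⟩ := exists_linearIndepOn_extension
    (linearIndepOn_empty K A.row) (Set.empty_subset Set.univ)
  have hfin : b.Finite := Set.toFinite b
  have hspan' : ∀ v, A v ∈ Submodule.span K (A.row '' b) := fun v =>
    hspan ⟨v, Set.mem_univ v, rfl⟩
  refine ⟨hfin.toFinset, ?_, ?_⟩
  · rw [rank_eq_finrank_span_row]
    have : Submodule.span K (Set.range A.row) = Submodule.span K (A.row '' b) := by
      refine le_antisymm (Submodule.span_le.mpr ?_) (Submodule.span_mono (Set.image_subset_range _ _))
      rintro _ ⟨v, rfl⟩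
      exact hspan' v
    rw [this, ← Set.ncard_eq_toFinset_card b hfin, ← hli.injOn.ncard_image]
    have := Fintype.ofFinite (A.row '' b)
    rw [finrank_span_set_eq_card hli.id_image, Set.ncard_eq_toFinset_card']
  · intro y hy0 hy
    -- The rows in `b` span all rows, so `A y = 0` everywhere; skew-symmetry turns this into a
    -- relation among the independent rows in `b`.
    have hall : ∀ v, (A *ᵥ y) v = 0 := by
      intro v
      have : Submodule.span K (A.row '' b) ≤
          LinearMap.ker (LinearMap.lsum K (fun _ : V => K) K fun u => LinearMap.mulRight K (y u)) := by
        rw [Submodule.span_le]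
        rintro _ ⟨u, hu, rfl⟩
        have := hy u (by simpa using hu)
        simpa [mulVec, dotProduct] using this
      have := this (hspan' v)
      simpa [mulVec, dotProduct] using this
    have hcomb : ∑ u ∈ hfin.toFinset, y u • A.row u = 0 := by
      funext v
      rw [Finset.sum_subset (Finset.subset_univ _) (fun u _ hu => by rw [hy0 u hu, zero_smul])]
      have h1 := hall v
      simp only [mulVec, dotProduct] at h1
      simp only [Finset.sum_apply, Pi.smul_apply, smul_eq_mul, Pi.zero_apply, Matrix.row]
      rw [← neg_eq_zero, ← h1, ← Finset.sum_neg_distrib]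
      refine Finset.sum_congr rfl fun u _ => ?_
      simp only [hA, Matrix.sub_apply, transpose_apply]
      ring
    funext v
    by_cases hv : v ∈ hfin.toFinset
    · have hli' : LinearIndepOn K A.row (hfin.toFinset : Set V) := by simpa using hli
      exact linearIndepOn_finset_iff.mp hli' y hcomb v hv
    · exact hy0 v hv

theorem rank_le_two_mul_matchingNumber {U : Matrix V V K} {G : SimpleGraph V}
    (hG : ∀ i j, (U - Uᵀ) i j ≠ 0 → G.Adj i j) : (U - Uᵀ).rank ≤ 2 * matchingNumber G := by
  obtain ⟨s, hs, hns⟩ := exists_nonsingularOn U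
  obtain ⟨M, hM, hMv⟩ := hns.exists_matching hG _ s rfl
  rw [← hs, ← Set.ncard_coe_finset, ← hMv, verts_ncard_of_isMatching hM]
  exact Nat.mul_le_mul_left 2 (le_matchingNumber hM)

end CongestedClique

/-! ### The matching number as the rank of a random Hankel matrix -/

namespace CongestedClique

open Matrix

variable {n : ℕ}

open Classical in
/-- The part above the diagonal of the Tutte matrix of `G`, with weights `x`. -/
noncomputable def upper {R : Type*} [CommRing R] (G : SimpleGraph (Fin n))
    (x : Fin n → Fin n → R) : Matrix (Fin n) (Fin n) R :=
  of fun i j => if i < j ∧ G.Adj i j then x i j else 0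

/-- The Tutte matrix of `G`, with weights `x`. -/
noncomputable def tutte {R : Type*} [CommRing R] (G : SimpleGraph (Fin n))
    (x : Fin n → Fin n → R) : Matrix (Fin n) (Fin n) R :=
  upper G x - (upper G x)ᵀ

/-- The Hankel matrix of the sequence `1ᵀ M ^ k 1`, `k ≥ 1`. -/
noncomputable def hankel {R : Type*} [CommRing R] (M : Matrix (Fin n) (Fin n) R) :
    Matrix (Fin n) (Fin n) R :=
  of fun i j => ∑ v, (M ^ ((i : ℕ) + j + 1) *ᵥ fun _ => 1) v

theorem upper_map {R R' : Type*} [CommRing R] [CommRing R'] (f : R →+* R')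
    (G : SimpleGraph (Fin n)) (x : Fin n → Fin n → R) :
    (upper G x).map f = upper G fun i j => f (x i j) := by
  ext i j
  simp [upper, apply_ite f]

theorem tutte_map {R R' : Type*} [CommRing R] [CommRing R'] (f : R →+* R')
    (G : SimpleGraph (Fin n)) (x : Fin n → Fin n → R) :
    (tutte G x).map f = tutte G fun i j => f (x i j) := by
  rw [tutte, tutte, ← upper_map f]
  ext i j
  simp

theorem hankel_map {R R' : Type*} [CommRing R] [CommRing R'] (f : R →+* R')
    (M : Matrix (Fin n) (Fin n) R) : (hankel M).map f = hankel (M.map f) := by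
  ext i j
  have h : ∀ k, (M.map f) ^ k = (M ^ k).map f := fun k => by
    have := map_pow f.mapMatrix M k
    simpa using this.symm
  simp [hankel, h, mulVec, dotProduct]

/-- Entry `(i, j)` is the row 1ᵀM^i times `M` times the column M^j 1, so the matrix factors through
`M`. -/
theorem rank_hankel_le {K : Type*} [Field K] (M : Matrix (Fin n) (Fin n) K) :
    (hankel M).rank ≤ M.rank := by
  let P : Matrix (Fin n) (Fin n) K := of fun i => (fun _ => 1) ᵥ* (M ^ (i : ℕ))
  let Q : Matrix (Fin n) (Fin n) K := (of fun j => M ^ (j : ℕ) *ᵥ fun _ => 1)ᵀ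
  have h : hankel M = P * (M * Q) := by
    ext i j
    have e1 : ∀ v, (M * Q) v j = (M ^ ((j : ℕ) + 1) *ᵥ fun _ => 1) v := by
      intro v
      rw [pow_succ', ← mulVec_mulVec]
      rfl
    have e2 : (P * (M * Q)) i j =
        ((fun _ => 1) ᵥ* (M ^ (i : ℕ))) ⬝ᵥ (M ^ ((j : ℕ) + 1) *ᵥ fun _ => 1) := by
      rw [mul_apply]
      exact Finset.sum_congr rfl fun v _ => by rw [e1]; rfl
    rw [e2, ← dotProduct_mulVec, mulVec_mulVec, ← pow_add, ← add_assoc]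
    simp [hankel, dotProduct]
  rw [h]
  exact (rank_mul_le_right _ _).trans (rank_mul_le_left _ _)

theorem rank_hankel_tutte_le {K : Type*} [Field K] (G : SimpleGraph (Fin n))
    (x : Fin n → Fin n → K) (N : Matrix (Fin n) (Fin n) K) :
    (hankel (tutte G x * N)).rank ≤ 2 * matchingNumber G := by
  refine (rank_hankel_le _).trans ((rank_mul_le_left _ _).trans
    (rank_le_two_mul_matchingNumber fun i j hij => ?_))
  by_contra hadj
  apply hij
  have : ¬ G.Adj j i := fun h => hadj h.symm
  simp [upper, hadj, this]

/-- For a diagonal matrix the sequence consists of power sums of the nonzero entries, so the minor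
splits into Vandermonde transpose, diagonal and Vandermonde. -/
theorem det_hankel_diagonal_ne_zero {K : Type*} [Field K] {r : ℕ} (hr : r ≤ n)
    (d : Fin n → K) (φ : Fin r ↪ Fin n) (hd : ∀ v, v ∉ Set.range φ → d v = 0)
    (hd0 : ∀ a, d (φ a) ≠ 0) (hinj : Function.Injective fun a => d (φ a)) :
    ((hankel (diagonal d)).submatrix (Fin.castLE hr) (Fin.castLE hr)).det ≠ 0 := by
  have h : (hankel (diagonal d)).submatrix (Fin.castLE hr) (Fin.castLE hr) =
      (vandermonde fun a => d (φ a))ᵀ * (diagonal (fun a => d (φ a)) *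
        vandermonde fun a => d (φ a)) := by
    ext i j
    rw [mul_apply]
    simp only [hankel, submatrix_apply, of_apply, diagonal_pow, mulVec_diagonal, Pi.pow_apply,
      Fin.val_castLE, mul_one, transpose_apply, diagonal_mul, vandermonde_apply]
    have : ∑ v, d v ^ ((i : ℕ) + j + 1) = ∑ v ∈ Finset.univ.map φ, d v ^ ((i : ℕ) + j + 1) := by
      symm
      refine Finset.sum_subset (Finset.subset_univ _) fun v _ hv => ?_
      rw [hd v (by simpa using hv), zero_pow (Nat.succ_ne_zero _)]
    rw [this, Finset.sum_map]
    exact Finset.sum_congr rfl fun a _ => by ring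
  rw [h, det_mul, det_mul, det_transpose, det_diagonal]
  have hv := det_vandermonde_ne_zero_iff.mpr hinj
  exact mul_ne_zero hv (mul_ne_zero (Finset.prod_ne_zero_iff.mpr fun a _ => hd0 a) hv)

/-- There are weights for which a Hankel minor of order twice the matching number is nonzero. -/
theorem exists_weights {K : Type*} [Field K] (c : Fin n ↪ Kˣ) (G : SimpleGraph (Fin n))
    (hr : 2 * matchingNumber G ≤ n) : ∃ x y : Fin n → Fin n → K,
      ((hankel (tutte G x * of y)).submatrix (Fin.castLE hr) (Fin.castLE hr)).det ≠ 0 := by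
  classical
  obtain ⟨M, hM, hMn⟩ := exists_maximum_matching G
  let x : Fin n → Fin n → K := fun i j => if M.Adj i j then 1 else 0
  have hT : ∀ i j, tutte G x i j = if M.Adj i j then (if i < j then 1 else -1) else 0 := by
    intro i j
    by_cases h : M.Adj i j
    · have h' := h.symm
      have hg := M.adj_sub h
      have hg' := M.adj_sub h'
      rcases lt_or_gt_of_ne hg.ne with hlt | hlt
      · simp [tutte, upper, x, h, hg, hlt, hlt.not_gt]
      · simp [tutte, upper, x, h, h', hg', hlt, hlt.not_gt]
    · have h' : ¬ M.Adj j i := fun hh => h hh.symm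
      simp [tutte, upper, x, h, h']
  -- With weights supported on a maximum matching, the square is `-1` on the matched vertices. This
  -- dictates the second factor below, which makes the product diagonal.
  have hTT : ∀ i j, (tutte G x * tutte G x) i j = if i = j ∧ i ∈ M.verts then -1 else 0 := by
    intro i j
    rw [mul_apply]
    by_cases hi : i ∈ M.verts
    · obtain ⟨p, hp, hpu⟩ := hM hi
      rw [Finset.sum_eq_single p]
      · by_cases hij : i = j
        · subst hij
          have hne := (M.adj_sub hp).ne
          rcases lt_or_gt_of_ne hne with hlt | hlt
          · simp [hT, hp, hp.symm, hi, hlt, hlt.not_gt]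
          · simp [hT, hp, hp.symm, hi, hlt, hlt.not_gt]
        · have : ¬ M.Adj p j := fun h => hij (hM.eq_of_adj_left hp.symm h)
          simp [hT, this, hij]
      · intro k _ hk
        have : ¬ M.Adj i k := fun h => hk (hpu k h)
        simp [hT, this]
      · simp
    · rw [if_neg (fun h => hi h.2)]
      refine Finset.sum_eq_zero fun k _ => ?_
      have : ¬ M.Adj i k := fun h => hi (M.edge_vert h)
      simp [hT, this]
  let d : Fin n → K := fun v => if v ∈ M.verts then (c v : K) else 0
  refine ⟨x, -(tutte G x * diagonal fun v => (c v : K)), ?_⟩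
  have hdiag : tutte G x * of (-(tutte G x * diagonal fun v => (c v : K))) = diagonal d := by
    change tutte G x * (-(tutte G x * diagonal fun v => (c v : K))) = diagonal d
    rw [mul_neg, ← mul_assoc]
    ext i j
    rw [Matrix.neg_apply, mul_diagonal, hTT, diagonal_apply]
    by_cases hij : i = j
    · subst hij
      by_cases hi : i ∈ M.verts <;> simp [d, hi]
    · simp [hij]
  rw [hdiag]
  have hcard : Fintype.card (Fin (2 * matchingNumber G)) = Fintype.card M.verts := by
    rw [Fintype.card_fin, ← hMn, ← verts_ncard_of_isMatching hM, ← Nat.card_coe_set_eq,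
      Nat.card_eq_fintype_card]
  let e := Fintype.equivOfCardEq hcard
  have hd : ∀ a, d (e a) = c (e a) := fun a => if_pos (e a).2
  refine det_hankel_diagonal_ne_zero hr d ⟨fun a => (e a : Fin n), fun a b h =>
    e.injective (Subtype.ext h)⟩ (fun v hv => ?_) (fun a => ?_) (fun a b h => ?_)
  · by_cases hvM : v ∈ M.verts
    · exact absurd ⟨e.symm ⟨v, hvM⟩, congrArg Subtype.val (e.apply_symm_apply ⟨v, hvM⟩)⟩ hv
    · simp [d, hvM]
  · exact (hd a).symm ▸ (c (e a)).ne_zero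
  · have : (c (e a) : K) = c (e b) := by rw [← hd, ← hd]; exact h
    exact e.injective (Subtype.ext (c.injective (Units.ext this)))

/-! #### Degrees -/

theorem totalDegree_mul_entry_le {R σ : Type*} [CommRing R] {A B : Matrix (Fin n) (Fin n)
    (MvPolynomial σ R)} {a b : ℕ} (hA : ∀ i j, (A i j).totalDegree ≤ a)
    (hB : ∀ i j, (B i j).totalDegree ≤ b) (i j : Fin n) :
    ((A * B) i j).totalDegree ≤ a + b := by
  rw [mul_apply]
  refine MvPolynomial.totalDegree_finsetSum_le fun k _ => ?_
  exact (MvPolynomial.totalDegree_mul _ _).trans (add_le_add (hA i k) (hB k j))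

theorem totalDegree_pow_entry_le {R σ : Type*} [CommRing R] {A : Matrix (Fin n) (Fin n)
    (MvPolynomial σ R)} {a : ℕ} (hA : ∀ i j, (A i j).totalDegree ≤ a) (k : ℕ) (i j : Fin n) :
    ((A ^ k) i j).totalDegree ≤ k * a := by
  induction k generalizing i j with
  | zero =>
    rw [pow_zero, one_apply]
    split_ifs <;> simp
  | succ k ih =>
    rw [pow_succ, Nat.succ_mul]
    exact totalDegree_mul_entry_le ih hA i j

theorem totalDegree_det_le {R ι : Type*} [CommRing R] {r : ℕ} {A : Matrix (Fin r) (Fin r)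
    (MvPolynomial ι R)} {a : ℕ} (hA : ∀ i j, (A i j).totalDegree ≤ a) :
    A.det.totalDegree ≤ r * a := by
  rw [det_apply']
  refine MvPolynomial.totalDegree_finsetSum_le fun σ _ => ?_
  refine (MvPolynomial.totalDegree_mul _ _).trans ?_
  have h1 : (((Equiv.Perm.sign σ : ℤˣ) : ℤ) : MvPolynomial ι R).totalDegree = 0 := by
    rcases Int.units_eq_one_or (Equiv.Perm.sign σ) with h | h <;> simp [h]
  rw [h1, zero_add]
  refine (MvPolynomial.totalDegree_finsetProd _ _).trans ?_
  refine (Finset.sum_le_sum fun i _ => hA _ _).trans ?_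
  simp

/-- The Schwartz–Zippel lemma over a finite field, for an arbitrary finite set of variables. -/
theorem card_eval_eq_zero_le {K σ : Type*} [Field K] [Fintype K] [Fintype σ]
    {f : MvPolynomial σ K} (hf : f ≠ 0) :
    (Nat.card {p : σ → K // MvPolynomial.eval p f = 0} : ℝ) / Nat.card (σ → K) ≤
      f.totalDegree / Fintype.card K := by
  classical
  let e := Fintype.equivFin σ
  let f' := MvPolynomial.rename e f
  have hf' : f' ≠ 0 := fun h => hf (MvPolynomial.rename_injective e e.injective (by
    rw [map_zero]; exact h))
  have h := MvPolynomial.schwartz_zippel_totalDegree hf' Finset.univ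
  have hdeg : f'.totalDegree = f.totalDegree := MvPolynomial.totalDegree_renameEquiv e f
  have hc1 : Nat.card {p : σ → K // MvPolynomial.eval p f = 0} =
      (Finset.filter (fun q => MvPolynomial.eval q f' = 0)
        (Fintype.piFinset fun _ : Fin (Fintype.card σ) => (Finset.univ : Finset K))).card := by
    have e2 : {p : σ → K // MvPolynomial.eval p f = 0} ≃
        {q : Fin (Fintype.card σ) → K // MvPolynomial.eval q f' = 0} :=
      (e.arrowCongr (Equiv.refl K)).subtypeEquiv fun p => by
        have : MvPolynomial.eval ((e.arrowCongr (Equiv.refl K)) p) f' = MvPolynomial.eval p f := by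
          rw [MvPolynomial.eval_rename]
          congr 2
          funext s
          simp [Equiv.arrowCongr]
        rw [this]
    rw [Nat.card_congr e2, Nat.card_eq_fintype_card, Fintype.card_subtype]
    congr 1
  have hc2 : Nat.card (σ → K) = Fintype.card K ^ Fintype.card σ := by
    rw [Nat.card_eq_fintype_card, Fintype.card_fun]
  rw [hc1, hc2, ← hdeg]
  have h' : (((Finset.filter (fun q => MvPolynomial.eval q f' = 0)
        (Fintype.piFinset fun _ : Fin (Fintype.card σ) => (Finset.univ : Finset K))).card /
        (Finset.univ : Finset K).card ^ Fintype.card σ : ℚ≥0) : ℝ) ≤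
      ((f'.totalDegree / (Finset.univ : Finset K).card : ℚ≥0) : ℝ) := by exact_mod_cast h
  push_cast at h'
  simpa using h'

/-- For random weights, the rank of the Hankel matrix is twice the matching number with high
probability. -/
theorem le_prob_rank_hankel {K : Type*} [Field K] [Fintype K] (hK : n < Fintype.card K)
    (G : SimpleGraph (Fin n)) :
    1 - 4 * (n : ℝ) ^ 2 / Fintype.card K ≤
      (Nat.card {p : Fin n × Bool × Fin n → K // (hankel (tutte G (fun i j => p (i, false, j)) *
        of fun i j => p (i, true, j))).rank = 2 * matchingNumber G} : ℝ) /
      Nat.card (Fin n × Bool × Fin n → K) := by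
  classical
  have hr : 2 * matchingNumber G ≤ n := by
    obtain ⟨M, hM, hMn⟩ := exists_maximum_matching G
    rw [← hMn, ← verts_ncard_of_isMatching hM]
    simpa using Set.ncard_le_card M.verts
  have hc : Nonempty (Fin n ↪ Kˣ) := Function.Embedding.nonempty_of_card_le (by
    rw [Fintype.card_fin, Fintype.card_units]; omega)
  obtain ⟨c⟩ := hc
  obtain ⟨x, y, hxy⟩ := exists_weights c G hr
  let X : Fin n → Fin n → MvPolynomial (Fin n × Bool × Fin n) K :=
    fun i j => MvPolynomial.X (i, false, j)
  let Y : Fin n → Fin n → MvPolynomial (Fin n × Bool × Fin n) K :=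
    fun i j => MvPolynomial.X (i, true, j)
  let D := (hankel (tutte G X * of Y)).submatrix (Fin.castLE hr) (Fin.castLE hr)
  have heval : ∀ p : Fin n × Bool × Fin n → K, MvPolynomial.eval p D.det =
      ((hankel (tutte G (fun i j => p (i, false, j)) *
        of fun i j => p (i, true, j))).submatrix (Fin.castLE hr) (Fin.castLE hr)).det := by
    intro p
    rw [RingHom.map_det, RingHom.mapMatrix_apply, ← submatrix_map, hankel_map, Matrix.map_mul,
      tutte_map]
    congr 4
    · simp [X]
    · ext i j; simp [Y]
  have hne : D.det ≠ 0 := by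
    intro h0
    have := heval fun q => if q.2.1 then y q.1 q.2.2 else x q.1 q.2.2
    rw [h0, map_zero] at this
    exact hxy this.symm
  have hdegT : ∀ i j, (tutte G X i j).totalDegree ≤ 1 := by
    have hU : ∀ i j, (upper G X i j).totalDegree ≤ 1 := by
      intro i j
      simp only [upper, of_apply]
      split_ifs
      · simp [X]
      · simp
    intro i j
    exact (MvPolynomial.totalDegree_sub _ _).trans (max_le (hU i j) (hU j i))
  have hdegM := totalDegree_mul_entry_le hdegT (B := of Y) (b := 1) (fun i j => by simp [Y])
  -- Entries of the product have degree at most two, and the exponent `i + j + 1` is below `2 * n`.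
  have hdegH : ∀ i j, (D i j).totalDegree ≤ 4 * n := by
    intro i j
    simp only [D, submatrix_apply, hankel, of_apply]
    refine MvPolynomial.totalDegree_finsetSum_le fun v _ => ?_
    simp only [mulVec, dotProduct, mul_one]
    refine MvPolynomial.totalDegree_finsetSum_le fun u _ => ?_
    refine (totalDegree_pow_entry_le hdegM _ _ _).trans ?_
    have h1 := i.2
    have h2 := j.2
    simp only [Fin.val_castLE]
    omega
  have hdeg : D.det.totalDegree ≤ 4 * n ^ 2 := by
    refine (totalDegree_det_le hdegH).trans ?_
    calc 2 * matchingNumber G * (4 * n) ≤ n * (4 * n) := Nat.mul_le_mul_right _ hr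
      _ = 4 * n ^ 2 := by ring
  have hSZ := card_eval_eq_zero_le hne
  have hsub : Nat.card {p : Fin n × Bool × Fin n → K // ¬ MvPolynomial.eval p D.det = 0} ≤
      Nat.card {p : Fin n × Bool × Fin n → K // (hankel (tutte G (fun i j => p (i, false, j)) *
        of fun i j => p (i, true, j))).rank = 2 * matchingNumber G} := by
    refine Nat.card_le_card_of_injective (Subtype.map id fun p hp => ?_)
      (Subtype.map_injective _ Function.injective_id)
    rw [heval] at hp
    refine le_antisymm (rank_hankel_tutte_le _ _ _) ?_
    have h1 := rank_of_isUnit _ ((isUnit_iff_isUnit_det _).mpr (isUnit_iff_ne_zero.mpr hp))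
    rw [Fintype.card_fin] at h1
    rw [id, ← h1]
    exact rank_submatrix_le _ _ _
  have hsum : Nat.card {p : Fin n × Bool × Fin n → K // MvPolynomial.eval p D.det = 0} +
      Nat.card {p : Fin n × Bool × Fin n → K // ¬ MvPolynomial.eval p D.det = 0} =
      Nat.card (Fin n × Bool × Fin n → K) := by
    simp only [Nat.card_eq_fintype_card]
    rw [← Fintype.card_sum]
    exact Fintype.card_congr (Equiv.sumCompl _)
  have hpos : (0 : ℝ) < Nat.card (Fin n × Bool × Fin n → K) := by
    exact_mod_cast Nat.card_pos
  have hKpos : (0 : ℝ) < Fintype.card K := by exact_mod_cast Fintype.card_pos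
  have h1 : (Nat.card {p : Fin n × Bool × Fin n → K // MvPolynomial.eval p D.det = 0} : ℝ) /
      Nat.card (Fin n × Bool × Fin n → K) ≤ 4 * (n : ℝ) ^ 2 / Fintype.card K := by
    refine hSZ.trans ?_
    gcongr
    exact_mod_cast hdeg
  have h2 : (Nat.card {p : Fin n × Bool × Fin n → K // ¬ MvPolynomial.eval p D.det = 0} : ℝ) =
      Nat.card (Fin n × Bool × Fin n → K) -
        Nat.card {p : Fin n × Bool × Fin n → K // MvPolynomial.eval p D.det = 0} := by
    rw [← hsum]; push_cast; ring
  calc 1 - 4 * (n : ℝ) ^ 2 / Fintype.card K ≤ 1 -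
      (Nat.card {p : Fin n × Bool × Fin n → K // MvPolynomial.eval p D.det = 0} : ℝ) /
      Nat.card (Fin n × Bool × Fin n → K) := by linarith
    _ = (Nat.card {p : Fin n × Bool × Fin n → K // ¬ MvPolynomial.eval p D.det = 0} : ℝ) /
      Nat.card (Fin n × Bool × Fin n → K) := by
        rw [h2, sub_div, div_self hpos.ne']
    _ ≤ _ := by gcongr

end CongestedClique

/-! ### The protocol -/

namespace CongestedClique

open Matrix

variable {n : ℕ}

/-- Iterated squaring: the products `M ^ c 1`, `c < 2 * n`, can be computed with `O(log n)`
distributed matrix products. -/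
theorem Reach.krylov {S : Type} {T w m t : ℕ} {κ : Profile n S} (h : Reach T κ) {K : Type}
    [Field K] (enc : K ↪ (Fin w → Message n)) (hr : HasRank K m t) (hm : 1 ≤ m) (ht : t ≤ n)
    (M : Input n S → Matrix (Fin n) (Fin n) K) (hM : ∀ v, Known (κ v) (fun ω => M ω v)) (ℓ : ℕ) :
    Reach (T + ℓ * (2 * (36 * w * ((n / m + 1) ^ 2 / n + 1))))
      (fun v a b => (M a ^ 2 ^ ℓ) v = (M b ^ 2 ^ ℓ) v ∧ ∀ c, c < 2 ^ ℓ → c < 2 * n →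
        (M a ^ c *ᵥ fun _ => 1) v = (M b ^ c *ᵥ fun _ => 1) v) := by
  set R := 36 * w * ((n / m + 1) ^ 2 / n + 1) with hR
  induction ℓ with
  | zero =>
    rw [zero_mul, add_zero]
    refine h.mono fun v a b hab => ?_
    simp only [pow_zero, pow_one, Nat.lt_one_iff]
    refine ⟨hM v a b hab, ?_⟩
    rintro c rfl _
    simp
  | succ ℓ ih =>
    -- One product with `M ^ 2 ^ ℓ` doubles the number of known vectors. The `n` columns suffice: `2
    -- ^ ℓ + c' < 2 * n` and `c' < 2 ^ ℓ` force `c' < n`.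
    let B : Input n S → Matrix (Fin n) (Fin n) K := fun ω => of fun i c =>
      if (c : ℕ) < 2 ^ ℓ then (M ω ^ (c : ℕ) *ᵥ fun _ => 1) i else 0
    have r1 := ih.matMul_of_hasRank enc hr hm ht (fun ω => M ω ^ 2 ^ ℓ) B
      (fun v a b hab => hab.1) (fun v => by
        intro a b hab
        funext c
        simp only [B, of_apply]
        split_ifs with hc
        · exact hab.2 c hc (by omega)
        · rfl)
    have r2 := r1.matMul_of_hasRank enc hr hm ht (fun ω => M ω ^ 2 ^ ℓ) (fun ω => M ω ^ 2 ^ ℓ)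
      (fun v a b hab => hab.1.1) (fun v a b hab => hab.1.1)
    have hT : T + ℓ * (2 * R) + R + R = T + (ℓ + 1) * (2 * R) := by ring
    rw [← hR, hT] at r2
    refine r2.mono ?_
    rintro v a b ⟨⟨⟨h1, h2⟩, h3⟩, h4⟩
    refine ⟨by simpa only [← pow_add, ← two_mul, ← pow_succ'] using h4, fun c hc hc' => ?_⟩
    by_cases hlt : c < 2 ^ ℓ
    · exact h2 c hlt hc'
    · obtain ⟨c', rfl⟩ := Nat.exists_eq_add_of_le (not_lt.mp hlt)
      rw [pow_succ] at hc
      have hc1 : c' < 2 ^ ℓ := by omega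
      have hc2 : c' < n := by omega
      have e : ∀ ω, (M ω ^ 2 ^ ℓ * B ω) v ⟨c', hc2⟩ =
          (M ω ^ (2 ^ ℓ + c') *ᵥ fun _ => 1) v := by
        intro ω
        rw [pow_add, ← mulVec_mulVec, mul_apply]
        simp only [B, of_apply, hc1, if_true]
        rfl
      rw [← e, ← e, h3]

/-- All nodes can compute the Hankel matrix of a matrix of which every node knows one row. -/
theorem Reach.hankel {S : Type} {T w m t : ℕ} {κ : Profile n S} (h : Reach T κ) {K : Type}
    [Field K] (enc : K ↪ (Fin w → Message n)) (hr : HasRank K m t) (hm : 1 ≤ m) (ht : t ≤ n)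
    (M : Input n S → Matrix (Fin n) (Fin n) K) (hM : ∀ v, Known (κ v) (fun ω => M ω v)) {ℓ : ℕ}
    (hℓ : 2 * n ≤ 2 ^ ℓ) :
    Reach (T + ℓ * (2 * (36 * w * ((n / m + 1) ^ 2 / n + 1))) + 8 * w)
      (fun _ a b => CongestedClique.hankel (M a) = CongestedClique.hankel (M b)) := by
  have f1 : ∀ v, Fintype.card {x : Fin n × Fin n × Bool // x.1 = v} ≤ 2 * n := fun v =>
    (card_fiber_le (fun x : Fin n × Fin n × Bool => x.1) (fun x => x.2) (fun _ _ h => h) v).trans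
      (by simp [mul_comm])
  have f2 : ∀ v, Fintype.card {x : Fin n × Fin n × Bool // x.2.1 = v} ≤ 2 * n := fun v =>
    (card_fiber_le (fun x : Fin n × Fin n × Bool => x.2.1) (fun x => (x.1, x.2.2)) (fun x y h => by
      simp only [Prod.mk.injEq] at h
      exact Prod.ext h.2.1 (Prod.ext h.1 h.2.2)) v).trans (by simp [mul_comm])
  -- Each node sums the coordinates for two of the `2 * n` exponents and broadcasts both sums; this
  -- covers all `i + j + 1`.
  let k : Fin n × Bool → ℕ := fun p => 2 * (p.1 : ℕ) + p.2.toNat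
  have hk : ∀ p, k p < 2 * n := by
    rintro ⟨c, b⟩
    have h1 := c.2
    have h2 := Bool.toNat_le b
    change 2 * (c : ℕ) + b.toNat < 2 * n
    omega
  have r1 := (h.krylov enc hr hm ht M hM ℓ).route enc (fun x : Fin n × Fin n × Bool => x.1)
    (fun x => x.2.1) f1 f2 (fun x ω => (M ω ^ k x.2 *ᵥ fun _ => 1) x.1)
    (fun x a b hab => hab.2 _ ((hk x.2).trans_le hℓ) (hk x.2))
  have r2 := r1.route enc (fun x : Fin n × Fin n × Bool => x.2.1) (fun x => x.1) f2 f1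
    (fun x ω => ∑ v, (M ω ^ k x.2 *ᵥ fun _ => 1) v)
    (fun x => Known.sum fun v _ a b hab => hab.2 (v, x.2) rfl)
  have hT : T + ℓ * (2 * (36 * w * ((n / m + 1) ^ 2 / n + 1))) + 2 * (2 * w) + 2 * (2 * w) =
      T + ℓ * (2 * (36 * w * ((n / m + 1) ^ 2 / n + 1))) + 8 * w := by ring
  rw [hT] at r2
  refine r2.mono ?_
  rintro v a b ⟨-, hab⟩
  ext i j
  simp only [CongestedClique.hankel, of_apply]
  have hi := i.2
  have hj := j.2
  obtain ⟨p, hp⟩ : ∃ p, k p = (i : ℕ) + j + 1 := by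
    rcases Nat.even_or_odd' ((i : ℕ) + j + 1) with ⟨q, hq | hq⟩
    · exact ⟨(⟨q, by omega⟩, false), by simp [k, hq]⟩
    · exact ⟨(⟨q, by omega⟩, true), by simp [k, hq]⟩
  rw [← hp]
  exact hab (v, p) rfl

/-- A value that all nodes know can be output by a protocol. -/
theorem Reach.exists_protocol {S : Type} [Fintype S] [Nonempty S] {T : ℕ} {κ : Profile n S}
    (h : Reach T κ) {Out : Type} [Nonempty Out] (hn : 0 < n) (f : Input n S → Out)
    (hf : ∀ v, Known (κ v) f) :
    ∃ P : CliqueProtocol n Out, ∀ G a, P.successProb T G a =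
      (Nat.card {ρ : Fin n → S // f (G, ρ) = a} : ℝ) / Nat.card (Fin n → S) := by
  obtain ⟨State, init, send, next, H⟩ := h
  have hφ : ∀ v, ∃ φ : State → Out, ∀ a, f a = φ (states init send next a T v) :=
    fun v => exists_factor _ _ fun a b e => hf v a b (H v a b e)
  choose φ hφ using hφ
  let P : CliqueProtocol n Out :=
    { State := State, Seed := S, init := init, send := send, next := next, output := φ }
  refine ⟨P, fun G a => ?_⟩
  have hrun : ∀ (ρ : Fin n → S) (k : ℕ), P.run G ρ k = states init send next (G, ρ) k := by
    intro ρ k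
    induction k with
    | zero => rfl
    | succ k ih =>
      funext v
      simp only [CliqueProtocol.run, states, ih]
      rfl
  have hiff : ∀ ρ : Fin n → S, (∀ v, P.output v (P.run G ρ T v) = a) ↔ f (G, ρ) = a := by
    intro ρ
    rw [hrun]
    constructor
    · intro hv
      rw [hφ ⟨0, hn⟩]
      exact hv ⟨0, hn⟩
    · rintro rfl v
      exact (hφ v _).symm
  unfold CliqueProtocol.successProb
  have hc : Nat.card {ρ : Fin n → P.Seed // ∀ v, P.output v (P.run G ρ T v) = a} =
      Nat.card {ρ : Fin n → S // f (G, ρ) = a} :=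
    Nat.card_congr (Equiv.subtypeEquivRight hiff)
  rw [hc]

/-- The number of edges of a maximum matching is computed with `O(log n)` distributed matrix
products over a finite field. -/
theorem exists_matching_protocol {w m t ℓ : ℕ} {K : Type} [Field K] [Fintype K]
    (hn : 0 < n) (enc : K ↪ (Fin w → Message n)) (hr : HasRank K m t) (hm : 1 ≤ m) (ht : t ≤ n)
    (hℓ : 2 * n ≤ 2 ^ ℓ) (hK : n < Fintype.card K) :
    ∃ P : CliqueProtocol n ℕ, ∀ G : SimpleGraph (Fin n), 1 - 4 * (n : ℝ) ^ 2 / Fintype.card K ≤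
      P.successProb (9 * w + (2 * ℓ + 1) * (36 * w * ((n / m + 1) ^ 2 / n + 1))) G
        (matchingNumber G) := by
  classical
  set R := 36 * w * ((n / m + 1) ^ 2 / n + 1) with hR
  let S := Bool → Fin n → K
  let U : Input n S → Matrix (Fin n) (Fin n) K := fun ω => upper ω.1 fun i j => ω.2 i false j
  let N : Input n S → Matrix (Fin n) (Fin n) K := fun ω => of fun i j => ω.2 i true j
  -- Each edge weight is drawn by the smaller endpoint. Node `v` receives column `v` of the upper
  -- part and combines it with its own row to get its row of the Tutte matrix.
  have r0 := (reach_zero (n := n) (S := S)).exchange enc (fun u v ω => U ω u v) (by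
    rintro u v ⟨G, ρ⟩ ⟨G', ρ'⟩ ⟨h1, h2⟩
    have hadj : G.Adj u v ↔ G'.Adj u v := Set.ext_iff.mp h1 v
    have h2' : ρ u = ρ' u := h2
    simp only [U, upper, of_apply, hadj, h2'])
  have r1 := r0.matMul_of_hasRank enc hr hm ht
    (fun ω => tutte ω.1 fun i j => ω.2 i false j) N (by
      rintro v ⟨G, ρ⟩ ⟨G', ρ'⟩ ⟨⟨h1, h2⟩, h3⟩
      funext j
      have hadj : G.Adj v j ↔ G'.Adj v j := Set.ext_iff.mp h1 j
      have h2' : ρ v = ρ' v := h2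
      have e : U (G, ρ) v j = U (G', ρ') v j := by
        simp only [U, upper, of_apply, hadj, h2']
      exact congrArg₂ (· - ·) e (h3 j)) (by
      rintro v a b ⟨⟨-, h2⟩, -⟩
      funext j
      simp only [N, of_apply, h2])
  have r2 := r1.hankel enc hr hm ht
    (fun ω => tutte ω.1 (fun i j => ω.2 i false j) * N ω) (fun v a b hab => hab.2) hℓ
  have hT : 0 + w + R + ℓ * (2 * R) + 8 * w = 9 * w + (2 * ℓ + 1) * R := by ring
  rw [← hR, hT] at r2
  obtain ⟨P, hP⟩ := r2.exists_protocol hn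
    (fun ω => (CongestedClique.hankel (tutte ω.1 (fun i j => ω.2 i false j) * N ω)).rank / 2)
    (fun v a b hab => by simp only [hab])
  refine ⟨P, fun G => ?_⟩
  rw [hP]
  refine (le_prob_rank_hankel hK G).trans ?_
  let E : (Fin n × Bool × Fin n → K) ≃ (Fin n → S) :=
    (Equiv.curry _ _ _).trans (Equiv.arrowCongr (Equiv.refl _) (Equiv.curry _ _ _))
  rw [Nat.card_congr E]
  gcongr
  refine Nat.card_le_card_of_injective (Subtype.map E fun p hp => ?_)
    (Subtype.map_injective _ E.injective)
  have : (CongestedClique.hankel (tutte G (fun i j => E p i false j) *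
      of fun i j => E p i true j)).rank = 2 * matchingNumber G := hp
  change (CongestedClique.hankel (tutte G (fun i j => E p i false j) *
      of fun i j => E p i true j)).rank / 2 = matchingNumber G
  rw [this]
  omega

end CongestedClique

/-! ### Round complexity -/

namespace CongestedClique

/-- Take the largest `m` with `C' * m ^ τ ≤ n`, the floor of `y`; if it is zero, the trivial
algorithm of size one serves. -/
theorem exists_block_size {R : Type*} [CommRing R] {τ C : ℝ} (hτ : 2 ≤ τ)
    (h : ∀ n : ℕ, 1 ≤ n → ∃ t : ℕ, (t : ℝ) ≤ C * (n : ℝ) ^ τ ∧ HasRank R n t) :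
    ∃ D : ℝ, 0 < D ∧ ∀ n : ℕ, 1 ≤ n → ∃ m t : ℕ, 1 ≤ m ∧ t ≤ n ∧ HasRank R m t ∧
      (n : ℝ) ^ (1 / τ) ≤ D * m := by
  set C' := max C 1 with hC'
  have hC1 : 1 ≤ C' := le_max_right _ _
  have hCpos : 0 < C' := by linarith
  have hτpos : 0 < τ := by linarith
  refine ⟨2 * C' ^ (1 / τ), by positivity, fun n hn => ?_⟩
  have hnpos : (0 : ℝ) < n := by exact_mod_cast hn
  set y := ((n : ℝ) / C') ^ (1 / τ) with hy
  have hy0 : 0 ≤ y := by positivity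
  have hny : (n : ℝ) ^ (1 / τ) = C' ^ (1 / τ) * y := by
    rw [hy, ← Real.mul_rpow hCpos.le (by positivity), mul_div_cancel₀ _ hCpos.ne']
  have hyτ : y ^ τ = n / C' := by
    rw [hy, ← Real.rpow_mul (by positivity), one_div_mul_cancel hτpos.ne', Real.rpow_one]
  suffices ∃ m t : ℕ, 1 ≤ m ∧ t ≤ n ∧ HasRank R m t ∧ y ≤ 2 * m by
    obtain ⟨m, t, h1, h2, h3, h4⟩ := this
    refine ⟨m, t, h1, h2, h3, ?_⟩
    rw [hny]
    have : 0 < C' ^ (1 / τ) := by positivity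
    nlinarith
  have hfl := Nat.lt_floor_add_one y
  rcases Nat.eq_zero_or_pos ⌊y⌋₊ with h0 | hpos
  · refine ⟨1, 1, le_rfl, hn, hasRank_one R, ?_⟩
    rw [h0] at hfl
    norm_num at hfl ⊢
    linarith
  · obtain ⟨t, ht, hr⟩ := h _ hpos
    refine ⟨⌊y⌋₊, t, hpos, ?_, hr, ?_⟩
    · have : (t : ℝ) ≤ n := by
        calc (t : ℝ) ≤ C * (⌊y⌋₊ : ℝ) ^ τ := ht
          _ ≤ C' * (⌊y⌋₊ : ℝ) ^ τ := by gcongr; exact le_max_left _ _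
          _ ≤ C' * y ^ τ := by gcongr; exact Nat.floor_le hy0
          _ = n := by rw [hyτ, mul_div_cancel₀ _ hCpos.ne']
      exact_mod_cast this
    · have : (1 : ℝ) ≤ ⌊y⌋₊ := by exact_mod_cast hpos
      linarith

/-- The quotient is at most `4 * n / m ^ 2`; the added one is absorbed because `2 ≤ τ` makes the
exponent nonnegative. -/
theorem matMul_rounds_le {τ D : ℝ} (hτ : 2 ≤ τ) {n m : ℕ} (hm : 1 ≤ m) (hmn : m ≤ n)
    (h : (n : ℝ) ^ (1 / τ) ≤ D * m) :
    (((n / m + 1) ^ 2 / n + 1 : ℕ) : ℝ) ≤ (4 * D ^ 2 + 1) * (n : ℝ) ^ (1 - 2 / τ) := by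
  have hτpos : 0 < τ := by linarith
  have hmpos : (0 : ℝ) < m := by exact_mod_cast hm
  have hnpos : (0 : ℝ) < n := by exact_mod_cast hm.trans hmn
  have hn1 : (1 : ℝ) ≤ n := by exact_mod_cast hm.trans hmn
  have hmn' : (m : ℝ) ≤ n := by exact_mod_cast hmn
  have h1 : (((n / m + 1) ^ 2 / n + 1 : ℕ) : ℝ) ≤ ((n : ℝ) / m + 1) ^ 2 / n + 1 := by
    push_cast
    refine add_le_add (Nat.cast_div_le.trans ?_) le_rfl
    push_cast
    gcongr
    exact Nat.cast_div_le
  have h2 : (n : ℝ) / m + 1 ≤ 2 * (n / m) := by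
    have : 1 ≤ (n : ℝ) / m := (one_le_div hmpos).mpr hmn'
    linarith
  have hpow : (n : ℝ) ^ (1 - 2 / τ) = n / ((n : ℝ) ^ (1 / τ)) ^ 2 := by
    rw [Real.rpow_sub hnpos, Real.rpow_one, ← Real.rpow_natCast ((n : ℝ) ^ (1 / τ)),
      ← Real.rpow_mul hnpos.le]
    congr 2
    push_cast
    ring
  have hge : 1 ≤ (n : ℝ) ^ (1 - 2 / τ) := by
    refine Real.one_le_rpow hn1 ?_
    have : 2 / τ ≤ 1 := (div_le_one hτpos).mpr hτ
    linarith
  have hxpos : 0 < (n : ℝ) ^ (1 / τ) := by positivity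
  have h3 : ((n : ℝ) / m + 1) ^ 2 / n ≤ 4 * D ^ 2 * (n : ℝ) ^ (1 - 2 / τ) := by
    calc ((n : ℝ) / m + 1) ^ 2 / n ≤ (2 * (n / m)) ^ 2 / n := by gcongr
      _ = 4 * n / (m : ℝ) ^ 2 := by field_simp; ring
      _ ≤ 4 * D ^ 2 * (n / ((n : ℝ) ^ (1 / τ)) ^ 2) := by
        rw [← mul_div_assoc, div_le_div_iff₀ (by positivity) (by positivity)]
        have : ((n : ℝ) ^ (1 / τ)) ^ 2 ≤ (D * m) ^ 2 := by gcongr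
        nlinarith
      _ = _ := by rw [hpow]
  linarith

theorem exists_doubling_steps {n : ℕ} (hn : 2 ≤ n) :
    ∃ ℓ : ℕ, 1 ≤ ℓ ∧ 2 * n ≤ 2 ^ ℓ ∧ (ℓ : ℝ) ≤ 3 / Real.log 2 * Real.log n := by
  have h2 : 1 < 2 * n := by omega
  refine ⟨Nat.clog 2 (2 * n), Nat.clog_pos one_lt_two h2, Nat.le_pow_clog one_lt_two _, ?_⟩
  have hlog2 : 0 < Real.log 2 := Real.log_pos one_lt_two
  have h1 := Nat.pow_pred_clog_lt_self one_lt_two h2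
  have hpos := Nat.clog_pos one_lt_two h2
  obtain ⟨k, hk⟩ : ∃ k, Nat.clog 2 (2 * n) = k + 1 := ⟨_, (Nat.succ_pred_eq_of_pos hpos).symm⟩
  rw [hk] at h1 ⊢
  have h3 : 2 ^ (k + 1) ≤ n ^ 3 := by
    rw [Nat.pred_succ] at h1
    rw [pow_succ]
    nlinarith [Nat.mul_le_mul hn hn]
  have h4 : Real.log ((2 : ℝ) ^ (k + 1)) ≤ Real.log ((n : ℝ) ^ 3) :=
    Real.log_le_log (by positivity) (by exact_mod_cast h3)
  rw [Real.log_pow, Real.log_pow] at h4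
  rw [div_mul_eq_mul_div, le_div_iff₀ hlog2]
  exact_mod_cast h4

/-- A finite extension field of polynomial size, with elements encoded in a constant number of
messages. -/
theorem exists_extension (F : Type*) [Field F] [Finite F] (c : ℕ) {n : ℕ} (hn : 2 ≤ n) :
    ∃ (K : Type) (_ : Field K) (_ : Fintype K) (_ : F →+* K),
      Nonempty (K ↪ (Fin (Nat.card F * 2 + c) → Message n)) ∧ n ^ c ≤ Fintype.card K := by
  obtain ⟨p, hp⟩ := CharP.exists F
  have : Fact p.Prime := ⟨CharP.char_is_prime F p⟩
  have hq : 1 < Nat.card F := Finite.one_lt_card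
  set q := Nat.card F with hqd
  -- The `+ 1` keeps the degree positive, at the cost of one factor `q`: `q ^ d ≤ q * q * n ^ c`.
  let d := Nat.clog q (n ^ c) + 1
  let K := FiniteField.Extension F p d
  have hcard : Nat.card K = q ^ d := FiniteField.natCard_extension F p d
  refine ⟨K, inferInstance, Fintype.ofFinite K, algebraMap F K, ?_, ?_⟩
  · have hle : q ^ d ≤ (2 ^ Nat.clog 2 n) ^ (q * 2 + c) := by
      have hclog : 1 ≤ Nat.clog 2 n := Nat.clog_pos one_lt_two hn
      have h1 : q ≤ (2 ^ Nat.clog 2 n) ^ q :=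
        Nat.lt_two_pow_self.le.trans (Nat.pow_le_pow_left (Nat.le_self_pow (by omega) 2) q)
      have h2 : q ^ Nat.clog q (n ^ c) ≤ q * n ^ c := by
        rcases Nat.lt_or_ge 1 (n ^ c) with h | h
        · have hlt := Nat.pow_pred_clog_lt_self hq h
          have hpos := Nat.clog_pos hq h
          calc q ^ Nat.clog q (n ^ c) = q * q ^ (Nat.clog q (n ^ c)).pred := by
                rw [← pow_succ', ← Nat.succ_eq_add_one, Nat.succ_pred_eq_of_pos hpos]
            _ ≤ q * n ^ c := Nat.mul_le_mul_left _ hlt.le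
        · rw [Nat.clog_of_right_le_one h, pow_zero]
          exact Nat.mul_pos (by omega) (by positivity)
      calc q ^ d = q ^ Nat.clog q (n ^ c) * q := pow_succ _ _
        _ ≤ q * n ^ c * q := Nat.mul_le_mul_right _ h2
        _ = q * q * n ^ c := by ring
        _ ≤ (2 ^ Nat.clog 2 n) ^ q * (2 ^ Nat.clog 2 n) ^ q * (2 ^ Nat.clog 2 n) ^ c :=
          Nat.mul_le_mul (Nat.mul_le_mul h1 h1)
            (Nat.pow_le_pow_left (Nat.le_pow_clog one_lt_two n) c)
        _ = (2 ^ Nat.clog 2 n) ^ (q * 2 + c) := by rw [pow_add, pow_mul, sq]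
    have := Fintype.ofFinite K
    refine Function.Embedding.nonempty_of_card_le ?_
    rw [Fintype.card_eq_nat_card, hcard]
    simpa using hle
  · rw [Fintype.card_eq_nat_card, hcard]
    exact (Nat.le_pow_clog hq _).trans (Nat.pow_le_pow_right hq.le (Nat.le_succ _))

theorem randomizedRoundsO_matchingNumber {F : Type*} [Field F] [Finite F] {τ C : ℝ} (hτ : 2 ≤ τ)
    (h : ∀ n : ℕ, 1 ≤ n → ∃ t : ℕ, (t : ℝ) ≤ C * (n : ℝ) ^ τ ∧ HasRank F n t) :
    RandomizedRoundsO (fun _ G => matchingNumber G)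
      (fun n => (n : ℝ) ^ (1 - 2 / τ) * Real.log n) := by
  obtain ⟨D, hD, hsize⟩ := exists_block_size hτ h
  intro c
  -- A field of size at least `n ^ (c + 4)` has failure bound `4 * n ^ 2 / n ^ (c + 4) ≤ 1 / n ^ c`,
  -- as `4 ≤ n ^ 2`.
  set w := Nat.card F * 2 + (c + 4) with hw
  -- `117 = 9 + 3 * 36`, using `2 * ℓ + 1 ≤ 3 * ℓ`.
  refine ⟨117 * w * (3 / Real.log 2) * (4 * D ^ 2 + 1), fun n hn => ?_⟩
  have hn1 : 1 ≤ n := by omega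
  obtain ⟨K, _, _, φ, ⟨enc⟩, hK⟩ := exists_extension F (c + 4) hn
  obtain ⟨m, t, hm, ht, hr, hnm⟩ := hsize n hn1
  obtain ⟨ℓ, hℓ1, hℓ, hℓn⟩ := exists_doubling_steps hn
  have hmn : m ≤ n := (Nat.le_mul_self m).trans (hr.sq_le.trans ht)
  have hKn : n < Fintype.card K := by
    refine lt_of_lt_of_le ?_ hK
    calc n = n ^ 1 := (pow_one n).symm
      _ < n ^ (c + 4) := Nat.pow_lt_pow_right (by omega) (by omega)
  obtain ⟨P, hP⟩ := exists_matching_protocol hn1 enc (hr.map φ) hm ht hℓ hKn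
  refine ⟨P, _, ?_, fun G => le_trans ?_ (hP G)⟩
  · have hQ := matMul_rounds_le hτ hm hmn hnm
    set Q := (n / m + 1) ^ 2 / n + 1 with hQd
    have hQ1 : 1 ≤ Q := Nat.le_add_left 1 _
    have h1 : 9 * w + (2 * ℓ + 1) * (36 * w * Q) ≤ 117 * w * ℓ * Q := by
      have e1 : w * 1 ≤ w * (ℓ * Q) := Nat.mul_le_mul_left w (Nat.mul_pos hℓ1 hQ1)
      have e2 : (2 * ℓ + 1) * (36 * w * Q) ≤ (3 * ℓ) * (36 * w * Q) :=
        Nat.mul_le_mul_right _ (by omega)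
      calc _ ≤ 9 * (w * (ℓ * Q)) + (3 * ℓ) * (36 * w * Q) := by omega
        _ = 117 * w * ℓ * Q := by ring
    calc ((9 * w + (2 * ℓ + 1) * (36 * w * Q) : ℕ) : ℝ) ≤ ((117 * w * ℓ * Q : ℕ) : ℝ) := by
          exact_mod_cast h1
      _ = 117 * w * ℓ * Q := by push_cast; ring
      _ ≤ 117 * w * (3 / Real.log 2 * Real.log n) * ((4 * D ^ 2 + 1) * (n : ℝ) ^ (1 - 2 / τ)) := by
          gcongr
      _ = _ := by ring
  · have hnpos : (0 : ℝ) < n := by exact_mod_cast hn1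
    have h1 : ((n : ℝ) ^ (c + 4)) ≤ Fintype.card K := by exact_mod_cast hK
    have h2 : 4 * (n : ℝ) ^ 2 / Fintype.card K ≤ 1 / (n : ℝ) ^ c := by
      rw [div_le_div_iff₀ (by exact_mod_cast Fintype.card_pos) (by positivity), one_mul]
      refine le_trans ?_ h1
      have h4 : (4 : ℝ) ≤ (n : ℝ) ^ 2 := by
        have : (2 : ℝ) ≤ n := by exact_mod_cast hn
        nlinarith
      calc 4 * (n : ℝ) ^ 2 * n ^ c ≤ (n : ℝ) ^ 2 * n ^ 2 * n ^ c := by gcongr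
        _ = (n : ℝ) ^ (c + 4) := by ring
    linarith

theorem RandomizedRoundsO.mono {Out : Type} {f : ∀ n : ℕ, SimpleGraph (Fin n) → Out} {g g' : ℕ → ℝ}
    (h : RandomizedRoundsO f g) (hg : ∀ n, 2 ≤ n → 0 ≤ g n ∧ g n ≤ g' n) :
    RandomizedRoundsO f g' := by
  intro c
  obtain ⟨C, hC⟩ := h c
  refine ⟨|C|, fun n hn => ?_⟩
  obtain ⟨P, T, hT, hP⟩ := hC n hn
  refine ⟨P, T, hT.trans ?_, hP⟩
  calc C * g n ≤ |C| * g n := mul_le_mul_of_nonneg_right (le_abs_self C) (hg n hn).1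
    _ ≤ |C| * g' n := mul_le_mul_of_nonneg_left (hg n hn).2 (abs_nonneg C)

/-- The rank bound for all sizes that results from a single bilinear algorithm. -/
theorem HasRank.exists_bound {R : Type*} [CommRing R] {τ : ℝ} (hτ : 0 ≤ τ) {n₀ t₀ : ℕ}
    (hn₀ : 2 ≤ n₀) (h : HasRank R n₀ t₀) (ht : (t₀ : ℝ) ≤ (n₀ : ℝ) ^ τ) :
    ∃ C : ℝ, ∀ n : ℕ, 1 ≤ n → ∃ t : ℕ, (t : ℝ) ≤ C * (n : ℝ) ^ τ ∧ HasRank R n t := by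
  refine ⟨(n₀ : ℝ) ^ τ, fun n hn => ?_⟩
  -- Rounding up to a power of `n₀` loses a factor `n₀` in size, hence `n₀ ^ τ` in rank.
  obtain ⟨j, hj1, hj2⟩ : ∃ j, n ≤ n₀ ^ j ∧ n₀ ^ j ≤ n₀ * n := by
    refine ⟨Nat.log n₀ n + 1, (Nat.lt_pow_succ_log_self (by omega) n).le, ?_⟩
    rw [pow_succ']
    exact Nat.mul_le_mul_left _ (Nat.pow_log_le_self _ (by omega))
  refine ⟨t₀ ^ j, ?_, (h.pow j).restrict hj1⟩
  have hn₀' : (0 : ℝ) ≤ n₀ := Nat.cast_nonneg _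
  calc ((t₀ ^ j : ℕ) : ℝ) = (t₀ : ℝ) ^ j := by push_cast; rfl
    _ ≤ ((n₀ : ℝ) ^ τ) ^ j := by gcongr
    _ = ((n₀ : ℝ) ^ j) ^ τ := by
      rw [← Real.rpow_natCast, ← Real.rpow_mul hn₀', mul_comm, Real.rpow_mul hn₀',
        Real.rpow_natCast]
    _ ≤ ((n₀ : ℝ) * n) ^ τ := by
      gcongr
      exact_mod_cast hj2
    _ = (n₀ : ℝ) ^ τ * (n : ℝ) ^ τ := Real.mul_rpow hn₀' (Nat.cast_nonneg _)

/-- The definition of the matrix product as a bilinear algorithm. -/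
theorem nonempty_algebraicAlgorithm (F : Type*) [Field F] (n : ℕ) :
    Nonempty (AlgebraicAlgorithm F n n (n * (n * n))) := by
  let e : Fin (n * (n * n)) ≃ Fin n × Fin n × Fin n :=
    finProdFinEquiv.symm.trans (Equiv.prodCongr (Equiv.refl _) finProdFinEquiv.symm)
  refine ⟨⟨fun i j μ => if (e μ).1 = i ∧ (e μ).2.1 = j then 1 else 0,
    fun i j μ => if (e μ).2.2 = i ∧ (e μ).2.1 = j then 1 else 0,
    fun i j μ => if (e μ).1 = i ∧ (e μ).2.2 = j then 1 else 0, fun A B i j => ?_⟩⟩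
  rw [← Equiv.sum_comp e.symm]
  simp only [Equiv.apply_symm_apply, Fintype.sum_prod_type, ite_and, ite_mul, one_mul, zero_mul,
    Finset.sum_ite_eq, Finset.sum_ite_eq', Finset.mem_univ, if_true, Finset.sum_ite_irrel, Finset.sum_const_zero]
  rw [Matrix.mul_apply]

theorem squareProductRankO_of_three_le (F : Type*) [Field F] {τ : ℝ} (hτ : 3 ≤ τ) :
    SquareProductRankO F τ := by
  refine ⟨1, fun n hn => ⟨n * (n * n), ?_, nonempty_algebraicAlgorithm F n⟩⟩
  have hn' : (1 : ℝ) ≤ n := by exact_mod_cast hn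
  calc ((n * (n * n) : ℕ) : ℝ) = (n : ℝ) ^ (3 : ℝ) := by
        push_cast
        rw [show (3 : ℝ) = ((3 : ℕ) : ℝ) by norm_num, Real.rpow_natCast]
        ring
    _ ≤ 1 * (n : ℝ) ^ τ := by
        rw [one_mul]
        exact Real.rpow_le_rpow_of_exponent_le hn' hτ

theorem two_le_of_forall {F : Type*} [Field F] {τ : ℝ}
    (h : ∀ ε : ℝ, 0 < ε → SquareProductRankO F (τ + ε)) : 2 ≤ τ :=
  le_of_forall_pos_le_add fun ε hε => two_le_of_squareProductRankO (h ε hε)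

theorem two_le_omegaExponent (F : Type*) [Field F] : 2 ≤ omegaExponent F :=
  le_csInf ⟨3, fun ε hε => squareProductRankO_of_three_le F (by linarith)⟩
    fun _ h => two_le_of_forall h

theorem squareProductRankO_omega (F : Type*) [Field F] {δ : ℝ} (hδ : 0 < δ) :
    SquareProductRankO F (omegaExponent F + δ) := by
  have hne : {τ : ℝ | ∀ ε : ℝ, 0 < ε → SquareProductRankO F (τ + ε)}.Nonempty :=
    ⟨3, fun ε hε => squareProductRankO_of_three_le F (by linarith)⟩
  obtain ⟨τ, hτ, hlt⟩ := exists_lt_of_csInf_lt hne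
    (show sInf {τ : ℝ | ∀ ε : ℝ, 0 < ε → SquareProductRankO F (τ + ε)} < omegaExponent F + δ from
      lt_add_of_pos_right _ hδ)
  have := hτ (omegaExponent F + δ - τ) (by linarith)
  rwa [add_sub_cancel] at this

/-- At a large size `n ^ δ` swallows the constant. A single algorithm without a constant is what can
be moved to one finite field and then raised to powers. -/
theorem exists_hasRank_le_rpow (F : Type*) [Field F] {δ : ℝ} (hδ : 0 < δ) :
    ∃ n t : ℕ, 2 ≤ n ∧ (t : ℝ) ≤ (n : ℝ) ^ (omegaExponent F + 2 * δ) ∧ HasRank F n t := by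
  obtain ⟨C, hC⟩ := SquareProductRankO.exists_hasRank (squareProductRankO_omega F hδ)
  have htend : Filter.Tendsto (fun n : ℕ => (n : ℝ) ^ δ) Filter.atTop Filter.atTop :=
    (tendsto_rpow_atTop hδ).comp tendsto_natCast_atTop_atTop
  obtain ⟨n, hn1, hn2⟩ := ((htend.eventually_ge_atTop C).and
    (Filter.eventually_ge_atTop 2)).exists
  obtain ⟨t, ht, hr⟩ := hC n (by omega)
  refine ⟨n, t, hn2, ht.trans ?_, hr⟩
  have hpos : (0 : ℝ) < n := by exact_mod_cast (show 0 < n by omega)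
  calc C * (n : ℝ) ^ (omegaExponent F + δ) ≤ (n : ℝ) ^ δ * (n : ℝ) ^ (omegaExponent F + δ) := by
        gcongr
    _ = (n : ℝ) ^ (omegaExponent F + 2 * δ) := by
        rw [← Real.rpow_add hpos]
        congr 1
        ring

end CongestedClique

theorem theorem7 (F : Type*) [Field F] :
    (∀ ε : ℝ, 0 < ε →
      RandomizedRoundsO (fun _ G => matchingNumber G)
        (fun n => (n : ℝ) ^ (1 - 2 / omegaExponent F + ε) * Real.log n)) ∧
    (Finite F → ∀ τ : ℝ, SquareProductRankO F τ →
      RandomizedRoundsO (fun _ G => matchingNumber G)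
        (fun n => (n : ℝ) ^ (1 - 2 / τ) * Real.log n)) := by
  refine ⟨fun ε hε => ?_, fun _ τ hτ => ?_⟩
  · obtain ⟨n₀, t₀, hn₀, ht₀, hr⟩ := CongestedClique.exists_hasRank_le_rpow F hε
    obtain ⟨k, _, _, hk⟩ := hr.exists_finite
    have hω := CongestedClique.two_le_omegaExponent F
    obtain ⟨C, hC⟩ := hk.exists_bound (by linarith) hn₀ ht₀
    refine CongestedClique.RandomizedRoundsO.mono
      (CongestedClique.randomizedRoundsO_matchingNumber (by linarith) hC) fun n hn => ?_
    have hn1 : (1 : ℝ) ≤ n := by exact_mod_cast (show 1 ≤ n by omega)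
    have hlog : 0 ≤ Real.log n := Real.log_nonneg hn1
    refine ⟨by positivity, mul_le_mul_of_nonneg_right ?_ hlog⟩
    refine Real.rpow_le_rpow_of_exponent_le hn1 ?_
    set ω := omegaExponent F
    -- The difference is `4 * ε / (ω * (ω + 2 * ε))`, whose denominator is at least four.
    have : 2 / ω - 2 / (ω + 2 * ε) ≤ ε := by
      rw [div_sub_div _ _ (by linarith) (by linarith), div_le_iff₀ (by nlinarith)]
      have h4 : 4 ≤ ω * (ω + 2 * ε) := by nlinarith
      nlinarith [mul_le_mul_of_nonneg_left h4 hε.le]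
    linarith
  · obtain ⟨C, hC⟩ := CongestedClique.SquareProductRankO.exists_hasRank hτ
    exact CongestedClique.randomizedRoundsO_matchingNumber
      (CongestedClique.two_le_of_squareProductRankO hτ) hC
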